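/- **Types.** Fix a set of tags. *Session types* are the (possibly infinite) regular trees coinductively generated by $S,T ::= \mathbf 1 \mid \bot \mid \oplus\{a^{m_a}:S_a\}_{a\in D} \mid \&\{a^{m_a}:S_a\}_{a\in D} \mid S\otimes T \mid S ⅋ T$, with $D$ a finite non-empty set of tags and annotations $m_a\in\mathbb N$. The connectives $\mathbf 1,\oplus,\otimes$ are positive, $\bot,\&,⅋$ are negative, and the dual $S^\perp$ exchanges $\mathbf 1/\bot$, $\oplus/\&$, $\otimes/⅋$ everywhere. Messages $\sigma$ are $*$, annotated tags $a^m$, and types. The transitions $S\xrightarrow{!\sigma}S'$ and $S\xrightarrow{?\sigma}S'$ have the rules (must) $\mathbf 1\xrightarrow{!*}\mathbf 1$; $\oplus\{a^{m_a}:S_a\}_{a\in D}\xrightarrow{!a^{m_a}}S_a$ for $a \in D$; $S\otimes T\xrightarrow{!S}T$; (may) if $S_a\xrightarrow{?\sigma}S_a'$ for all $a\in D$ then $\oplus\{a^{m_a}:S_a\}_{a\in D}\xrightarrow{?\sigma}\oplus\{a^{m_a}:S'_a\}_{a\in D}$; if $T\xrightarrow{?\sigma}T'$ then $S\otimes T\xrightarrow{?\sigma}S\otimes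 T'$; and the symmetric ones with $\bot,\&,⅋$ for $\mathbf 1,\oplus,\otimes$ and with $!,?$ exchanged. A transition holds iff it has a possibly infinite derivation with these rules, in which every judgment also has a finite derivation using in addition the corule (fair): if $S_k\xrightarrow{?\sigma}S_k'$ for some $k\in D$ then $\oplus\{a^{m_a}:S_a\}_{a\in D}\xrightarrow{?\sigma}\oplus\{a^{m_a}:S'_a\}_{a\in D}$ (and symmetrically for $\&$ and $!$). *Correct composition* $S\# T$ is the largest relation such that $S\#T$ implies: $S$ or $T$ is positive; if $S\xrightarrow{!\sigma}S'$ with $\sigma$ not a type, then $T\xrightarrow{?\sigma}T'$ and $S'\#T'$ for some $T'$; if $S\xrightarrow{!S_1}S_2$ then $T\xrightarrow{?T_1}T_2$, $S_1\#T_1$ and $S_2\#T_2$ for some $T_1,T_2$; and the two conditions with the roles of $S$ and $T$ exchanged. *Subtyping* $S\leqslant T$ means: $R\#T$ implies $R\#S$ for every $R$. **Processes** (up to renaming of bound channels) are $P,Q ::= x\leftrightarrow y \mid \overline x \mid x!a.P \mid x![y](P).Q \mid P\oplus Q \mid \mathsf{done} \mid A(\bar x)\mid \underline x.P \mid x?\{a:P_a\}_{a\in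 D}\mid x?[y].P\mid (x)(P\mid Q)$, namely link, signal output, tag output, channel output ($y$ bound in $P$ only), choice, termination, invocation, signal input, tag input, channel input ($y$ bound in $P$) and composition ($x$ bound in both). Each process name $A$ has one definition $A(\bar x)=P$, where $\bar x$ are exactly the free channels of $P$ and every invocation in $P$ is under a prefix or a choice. *Buffers* are $\mathcal B_x ::= [\,]\mid x!a.\mathcal B_x\mid x![y](P).\mathcal B_x$; $\mathcal B_y$ is $\mathcal B_x$ with $x$ replaced by $y$. *Structural precongruence* $\sqsupseteq$ is the least reflexive, transitive relation preserved by all process constructors such that (for $x\neq y$, bound names chosen fresh): $A(\bar x)\sqsupseteq P$ if $A(\bar x)=P$; $x\leftrightarrow y\sqsupseteq y\leftrightarrow x$; $(x)(P\mid Q)\sqsupseteq(x)(Q\mid P)$; $(x)(\mathcal B_x[\underline y.P]\mid Q)\sqsupseteq\underline y.(x)(\mathcal B_x[P]\mid Q)$; $(x)(\mathcal B_x[y?\{a:P_a\}]\mid Q)\sqsupseteq y?\{a:(x)(\mathcal B_x[P_a]\mid Q)\}$; $(x)(\mathcal B_x[y?[z].P]\mid Q)\sqsupseteq y?[z].(x)(\mathcal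 B_x[P]\mid Q)$; $(x)(\mathcal B_x[P]\mid \mathcal B'_x[x\leftrightarrow y])\sqsupseteq\mathcal B_y[(x)(P\mid\mathcal B'_x[x\leftrightarrow y])]$; $(x)(y![z](P).Q\mid R)\sqsupseteq y![z]((x)(P\mid R)).Q$ if $x$ is free in $P$ and not in $Q$; $(x)(\mathcal B_y[P]\mid Q)\sqsupseteq\mathcal B_y[(x)(P\mid Q)]$ if $x$ is not free in $\mathcal B_y$; $\mathcal B_x[y![z](P).Q]\sqsupseteq y![z](\mathcal B_x[P]).Q$ if $x$ is free in $P$; $\mathcal B_x[\mathcal B'_y[P]]\sqsupseteq\mathcal B'_y[\mathcal B_x[P]]$ if $x$ is free in $P$. *Reduction* $\to$ is the least relation such that: $P_1\oplus P_2\to P_k$; $(x)(x\leftrightarrow y\mid P)\to P\{y/x\}$; $(x)(\overline x\mid\underline x.P)\to P$ if $x$ is not free in $P$; $(x)(x!k.P\mid\mathcal B_x[x?\{a:Q_a\}_{a\in D}])\to(x)(P\mid\mathcal B_x[Q_k])$ for $k\in D$; $(x)(x![y](P).Q\mid\mathcal B_x[x?[y].R])\to(y)(P\mid(x)(Q\mid\mathcal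 B_x[R]))$ if $x$ is not free in $P$; $(x)(P\mid R)\to(x)(Q\mid R)$ and $\mathcal B_x[P]\to\mathcal B_x[Q]$ if $P\to Q$; $P\to Q$ if $P\sqsupseteq R\to Q$. **Typing.** Contexts $\Gamma,\Delta$ are partial maps from channels to session types; $\Gamma,\Delta$ is a union of contexts with disjoint domains. $\vdash^nP:\Gamma$ (with $n\in\mathbb N$) means that there is a possibly infinite derivation with the following rules: $\vdash^n\mathsf{done}:\emptyset$; $\vdash^n x\leftrightarrow y: x:S,y:T$ if $n\ge1$ and $S^\perp\leqslant T$; $\vdash^nA(\bar x):\overline{x:S}$ if $A(\bar x)=P$, $\vdash^mP:\overline{x:S}$ and $m\le n$; $\vdash^{1+n_k}P_1\oplus P_2:\Gamma$ if $\vdash^{n_i}P_i:\Gamma$ for $i=1,2$ and $k\in\{1,2\}$; $\vdash^{m+n}(x)(P\mid Q):\Gamma,\Delta$ if $\vdash^mP:\Gamma,x:S$, $\vdash^nQ:\Delta,x:T$ and $S\#T$; $\vdash^n\overline x:x:\mathbf 1$ if $n\ge1$; $\vdash^n\underline x.P:\Gamma,x:\bot$ if $\vdash^nP:\Gamma$;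 $\vdash^{1+m_k+n}x!k.P:\Gamma,x:\oplus\{a^{m_a}:S_a\}_{a\in D}$ if $k\in D$ and $\vdash^nP:\Gamma,x:S_k$; $\vdash^nx?\{a:P_a\}_{a\in D}:\Gamma,x:\&\{a^{m_a}:S_a\}_{a\in E}$ if $\emptyset\neq E\subseteq D$ and $\vdash^{n+m_a}P_a:\Gamma,x:S_a$ for every $a\in D$ (for some $m_a,S_a$ when $a\notin E$); $\vdash^{1+m+n}x![y](P).Q:\Gamma,\Delta,x:S\otimes T$ if $\vdash^mP:\Gamma,y:S$ and $\vdash^nQ:\Delta,x:T$; $\vdash^nx?[y].P:\Gamma,x:S⅋T$ if $\vdash^nP:\Gamma,y:S,x:T$. $P$ is *well typed in* $\Gamma$ if $\vdash^nP:\Gamma$ for some $n$. *Threads* are the processes generated as follows: $\mathsf{done}$, links, signal outputs and all inputs are threads, and $\mathcal B_x[P]$ is a thread if $P$ is. **Theorem.** (1) If $P$ is well typed in the empty context, then $P$ is deadlock free: for every $Q$ such that $P\to^*Q$ and $Q$ does not reduce, $Q\sqsupseteq\mathsf{done}$. (2) Every process $P$ that is well typed in some context $\Gamma$ either reduces ($P\to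 Q$ for some $Q$) or satisfies $P\sqsupseteq Q$ for some thread $Q$. -/

import Mathlib

namespace CaP

/-! ## Session types

The polarity `out` gives the positive connectives `1`, `⊕`, `⊗`; the polarity `inp` gives the
negative ones `⊥`, `&`, `⅋`. -/

/-- Polarity of a connective, and direction of an action (`out` is `!`, `inp` is `?`). -/
inductive Pol
  | out
  | inp

/-- The opposite polarity. -/
def Pol.flip : Pol → Pol
  | .out => .inp
  | .inp => .out

/-- The node labels of session types. The branches of a node `⊕` or `&` are indexed by a finite
nonempty set `D` of tags, and each tag `a` in `D` is annotated with a natural number `m a`. -/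
inductive Shape (Tag : Type)
  | unit (p : Pol)
  | branch (p : Pol) (D : Finset Tag) (hD : D.Nonempty) (m : {a // a ∈ D} → ℕ)
  | mult (p : Pol)

/-- The positions of the children of a node. -/
def Shape.Arity {Tag : Type} : Shape Tag → Type
  | .unit _ => Empty
  | .branch _ D _ _ => {a // a ∈ D}
  | .mult _ => Bool

/-- The polarity of a node. -/
def Shape.pol {Tag : Type} : Shape Tag → Pol
  | .unit p => p
  | .branch p _ _ _ => p
  | .mult p => p

theorem Shape.finite_arity {Tag : Type} (a : Shape Tag) : Finite a.Arity := by
  cases a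
  · exact inferInstanceAs (Finite Empty)
  · exact inferInstanceAs (Finite {a // a ∈ _})
  · exact inferInstanceAs (Finite Bool)

/-- The polynomial functor whose final coalgebra is made of the possibly infinite type trees. -/
def sig (Tag : Type) : PFunctor.{0, 0} := ⟨Shape Tag, Shape.Arity⟩

/-- Possibly infinite type trees. -/
def Tree (Tag : Type) : Type := (sig Tag).M

namespace Tree

variable {Tag : Type}

/-- The tree with root `a` and immediate subtrees `f`. -/
def node (a : Shape Tag) (f : a.Arity → Tree Tag) : Tree Tag :=
  PFunctor.M.mk (F := sig Tag) ⟨a, f⟩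

/-- The label of the root. -/
def root (t : Tree Tag) : Shape Tag := (PFunctor.M.dest (F := sig Tag) t).1

/-- The immediate subtrees. -/
def child (t : Tree Tag) (i : t.root.Arity) : Tree Tag := (PFunctor.M.dest (F := sig Tag) t).2 i

/-- `IsChild t s` holds when `s` is an immediate subtree of `t`. -/
def IsChild (t s : Tree Tag) : Prop := ∃ i, t.child i = s

/-- A tree is regular when it has finitely many distinct subtrees. -/
def Regular (t : Tree Tag) : Prop := {s | Relation.ReflTransGen IsChild t s}.Finite

theorem isChild_node {a : Shape Tag} {f : a.Arity → Tree Tag} {s : Tree Tag}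
    (h : IsChild (node a f) s) : ∃ i, f i = s := h

theorem regular_node (a : Shape Tag) (f : a.Arity → Tree Tag) (hf : ∀ i, (f i).Regular) :
    (node a f).Regular := by
  have := a.finite_arity
  refine ((Set.finite_singleton (node a f)).union (Set.finite_iUnion hf)).subset ?_
  intro s hs
  rcases Relation.ReflTransGen.cases_head hs with h | ⟨u, hu, hus⟩
  · exact Or.inl h.symm
  · obtain ⟨i, rfl⟩ := isChild_node hu
    exact Or.inr (Set.mem_iUnion.2 ⟨i, hus⟩)

/-- One layer of the dual of a tree. -/
def dualStep (t : Tree Tag) : sig Tag (Tree Tag) :=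
  match PFunctor.M.dest (F := sig Tag) t with
  | ⟨.unit p, f⟩ => ⟨.unit p.flip, f⟩
  | ⟨.branch p D hD m, f⟩ => ⟨.branch p.flip D hD m, f⟩
  | ⟨.mult p, f⟩ => ⟨.mult p.flip, f⟩

/-- The dual of a tree: every connective is turned into the one of opposite polarity, and tags
and annotations stay the same. -/
def dual (t : Tree Tag) : Tree Tag := PFunctor.M.corec dualStep t

theorem dualStep_child (t : Tree Tag) (i : (sig Tag).B (dualStep t).1) :
    IsChild t ((dualStep t).2 i) := by
  revert i
  unfold IsChild child dualStep root
  rcases h : PFunctor.M.dest (F := sig Tag) t with ⟨a, f⟩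
  cases a <;> exact fun i => ⟨i, rfl⟩

theorem isChild_dual {t s : Tree Tag} (h : IsChild t.dual s) :
    ∃ u, IsChild t u ∧ u.dual = s := by
  obtain ⟨i, rfl⟩ := h
  have key : PFunctor.M.dest (F := sig Tag) t.dual = (sig Tag).map dual (dualStep t) :=
    PFunctor.M.dest_corec dualStep t
  have gen : ∀ (x : sig Tag (Tree Tag)), x = (sig Tag).map dual (dualStep t) →
      ∀ i : (sig Tag).B x.1, ∃ u, IsChild t u ∧ u.dual = x.2 i := by
    rintro x rfl i
    exact ⟨(dualStep t).2 i, dualStep_child t i, rfl⟩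
  exact gen _ key i

theorem regular_dual {t : Tree Tag} (h : t.Regular) : t.dual.Regular := by
  refine (Set.Finite.image dual h).subset ?_
  intro s hs
  induction hs with
  | refl => exact ⟨t, Relation.ReflTransGen.refl, rfl⟩
  | tail _ hc ih =>
    obtain ⟨u, hu, rfl⟩ := ih
    obtain ⟨v, hv, rfl⟩ := isChild_dual hc
    exact ⟨v, Relation.ReflTransGen.tail hu hv, rfl⟩

end Tree

/-- Session types are the regular type trees. -/
def SType (Tag : Type) : Type := {t : Tree Tag // t.Regular}

namespace SType

variable {Tag : Type}

/-- `1` (for `out`) and `⊥` (for `inp`). -/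
def unit (p : Pol) : SType Tag :=
  ⟨Tree.node (.unit p) (fun e : Empty => e.elim),
    Tree.regular_node _ _ (fun e : Empty => e.elim)⟩

/-- `⊕{a : S a}` (for `out`) and `&{a : S a}` (for `inp`), with `a` ranging over `D` and annotated
with `m a`. -/
def branch (p : Pol) (D : Finset Tag) (hD : D.Nonempty) (m : {a // a ∈ D} → ℕ)
    (S : {a // a ∈ D} → SType Tag) : SType Tag :=
  ⟨Tree.node (.branch p D hD m) (fun i => (S i).1), Tree.regular_node _ _ (fun i => (S i).2)⟩

/-- `S ⊗ T` (for `out`) and `S ⅋ T` (for `inp`). -/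
def mult (p : Pol) (S T : SType Tag) : SType Tag :=
  ⟨Tree.node (.mult p) (fun b : Bool => (cond b T S).1),
    Tree.regular_node _ _ (fun b : Bool => (cond b T S).2)⟩

/-- The dual of a session type. -/
def dual (S : SType Tag) : SType Tag := ⟨S.1.dual, Tree.regular_dual S.2⟩

/-- The positive session types are those whose topmost connective is `1`, `⊕` or `⊗`. -/
def Pos (S : SType Tag) : Prop := S.1.root.pol = .out

end SType

/-! ## Asynchronous labelled transition system of session types -/

/-- What is exchanged by an action: a termination signal, an annotated tag, or a channel of a
given type. -/
inductive Msg (Tag : Type)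
  | star
  | tag (a : Tag) (m : ℕ)
  | chan (S : SType Tag)

/-- Signals and tags, as opposed to channels. -/
def Msg.FirstOrder {Tag : Type} : Msg Tag → Prop
  | .chan _ => False
  | _ => True

/-- Immediate transitions. -/
inductive Must {Tag : Type} (p : Pol) : Msg Tag → SType Tag → SType Tag → Prop
  | unit : Must p .star (.unit p) (.unit p)
  | branch (D hD m S) (k : {a // a ∈ D}) : Must p (.tag k.1 (m k)) (.branch p D hD m S) (S k)
  | mult (S T) : Must p (.chan S) (.mult p S T) T

/-- One application of a rule, with premises in `R`: immediate transitions, and transitions of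
polarity `p` that float through a connective of the opposite polarity (late inputs, early
outputs). -/
inductive Infer {Tag : Type} (p : Pol) (σ : Msg Tag) (R : SType Tag → SType Tag → Prop) :
    SType Tag → SType Tag → Prop
  | must {S S'} : Must p σ S S' → Infer p σ R S S'
  | mayBranch (D hD m S S') : (∀ i, R (S i) (S' i)) →
      Infer p σ R (.branch p.flip D hD m S) (.branch p.flip D hD m S')
  | mayMult (S T T') : R T T' → Infer p σ R (.mult p.flip S T) (.mult p.flip S T')

/-- Finite derivability with the same rules and, in addition, the corule `fair`, which needs a
derivation for one branch only. -/
inductive FinStep {Tag : Type} (p : Pol) (σ : Msg Tag) : SType Tag → SType Tag → Prop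
  | must {S S'} : Must p σ S S' → FinStep p σ S S'
  | mayBranch (D hD m S S') : (∀ i, FinStep p σ (S i) (S' i)) →
      FinStep p σ (.branch p.flip D hD m S) (.branch p.flip D hD m S')
  | mayMult (S T T') : FinStep p σ T T' → FinStep p σ (.mult p.flip S T) (.mult p.flip S T')
  | fair (D hD m S S') (k : {a // a ∈ D}) : FinStep p σ (S k) (S' k) →
      FinStep p σ (.branch p.flip D hD m S) (.branch p.flip D hD m S')

/-- The transition `S --pσ--> S'`, by bounded coinduction: it has a possibly infinite derivation
with the rules of `Infer`, each judgment of which is finitely derivable with the help of the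
corule. -/
def Step {Tag : Type} (p : Pol) (σ : Msg Tag) (S S' : SType Tag) : Prop :=
  ∃ R : SType Tag → SType Tag → Prop,
    (∀ T T', R T T' → FinStep p σ T T') ∧ (∀ T T', R T T' → Infer p σ R T T') ∧ R S S'

/-! ## Correct composition and subtyping -/

/-- Correct asynchronous composition relations. -/
structure IsCorrectComposition {Tag : Type} (R : SType Tag → SType Tag → Prop) : Prop where
  pos : ∀ {S T}, R S T → S.Pos ∨ T.Pos
  io : ∀ {S T σ T'}, R S T → σ.FirstOrder → Step .out σ T T' →
    ∃ S', Step .inp σ S S' ∧ R S' T'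
  oi : ∀ {S T σ S'}, R S T → σ.FirstOrder → Step .out σ S S' →
    ∃ T', Step .inp σ T T' ∧ R S' T'
  ios : ∀ {S T T₁ T₂}, R S T → Step .out (.chan T₁) T T₂ →
    ∃ S₁ S₂, Step .inp (.chan S₁) S S₂ ∧ R S₁ T₁ ∧ R S₂ T₂
  ois : ∀ {S T S₁ S₂}, R S T → Step .out (.chan S₁) S S₂ →
    ∃ T₁ T₂, Step .inp (.chan T₁) T T₂ ∧ R S₁ T₁ ∧ R S₂ T₂

/-- The composition of `S` and `T` is correct. -/
def Correct {Tag : Type} (S T : SType Tag) : Prop :=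
  ∃ R : SType Tag → SType Tag → Prop, IsCorrectComposition R ∧ R S T

/-- Fair asynchronous subtyping `S ≤ T`. -/
def FairSub {Tag : Type} (S T : SType Tag) : Prop :=
  ∀ R : SType Tag, Correct R T → Correct R S

/-! ## Processes

Channels are de Bruijn indices, so that processes are identified up to renaming of bound
channels: a binder binds the index `0` in its scope. -/

inductive Proc (Tag Name : Type)
  /-- `x ↔ y` -/
  | link (x y : ℕ)
  /-- `x![]`, the output of a termination signal -/
  | close (x : ℕ)
  /-- `x!a.P`, the output of a tag -/
  | select (x : ℕ) (a : Tag) (P : Proc Tag Name)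
  /-- `x![y](P).Q`, the output of a fresh channel `y`, bound in `P` only -/
  | fork (x : ℕ) (P Q : Proc Tag Name)
  /-- nondeterministic choice -/
  | choice (P Q : Proc Tag Name)
  /-- termination -/
  | done
  /-- the invocation of a process name -/
  | call (A : Name) (args : List ℕ)
  /-- `x?[].P`, the input of a termination signal -/
  | wait (x : ℕ) (P : Proc Tag Name)
  /-- `x?{a : P a}`, the input of a tag `a` in `D` -/
  | case (x : ℕ) (D : Finset Tag) (P : {a // a ∈ D} → Proc Tag Name)
  /-- `x?[y].P`, the input of a channel `y`, bound in `P` -/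
  | join (x : ℕ) (P : Proc Tag Name)
  /-- `(x)(P | Q)`, parallel composition, which binds `x` in both `P` and `Q` -/
  | cut (P Q : Proc Tag Name)

/-- Extension of a renaming to the scope of a binder. -/
def lift (ρ : ℕ → ℕ) : ℕ → ℕ
  | 0 => 0
  | n + 1 => ρ n + 1

/-- The renaming that replaces the innermost bound channel with `y` and removes its binder. -/
def inst (y : ℕ) : ℕ → ℕ
  | 0 => y
  | n + 1 => n

/-- The renaming that exchanges the two innermost bound channels. -/
def exch : ℕ → ℕ
  | 0 => 1
  | 1 => 0
  | n + 2 => n + 2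

namespace Proc

variable {Tag Name : Type}

/-- Renaming of the free channels. -/
def rename : (ℕ → ℕ) → Proc Tag Name → Proc Tag Name
  | ρ, link x y => link (ρ x) (ρ y)
  | ρ, close x => close (ρ x)
  | ρ, select x a P => select (ρ x) a (P.rename ρ)
  | ρ, fork x P Q => fork (ρ x) (P.rename (lift ρ)) (Q.rename ρ)
  | ρ, choice P Q => choice (P.rename ρ) (Q.rename ρ)
  | _, done => done
  | ρ, call A args => call A (args.map ρ)
  | ρ, wait x P => wait (ρ x) (P.rename ρ)
  | ρ, case x D P => case (ρ x) D (fun i => (P i).rename ρ)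
  | ρ, join x P => join (ρ x) (P.rename (lift ρ))
  | ρ, cut P Q => cut (P.rename (lift ρ)) (Q.rename (lift ρ))

/-- The set of free channels. -/
def fn : Proc Tag Name → Set ℕ
  | link x y => {x, y}
  | close x => {x}
  | select x _ P => {x} ∪ P.fn
  | fork x P Q => {x} ∪ {z | z + 1 ∈ P.fn} ∪ Q.fn
  | choice P Q => P.fn ∪ Q.fn
  | done => ∅
  | call _ args => {z | z ∈ args}
  | wait x P => {x} ∪ P.fn
  | case x _ P => {x} ∪ {z | ∃ i, z ∈ (P i).fn}
  | join x P => {x} ∪ {z | z + 1 ∈ P.fn}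
  | cut P Q => {z | z + 1 ∈ P.fn} ∪ {z | z + 1 ∈ Q.fn}

/-- Every invocation occurs under a prefix or a nondeterministic choice. -/
def Guarded : Proc Tag Name → Prop
  | call _ _ => False
  | cut P Q => P.Guarded ∧ Q.Guarded
  | _ => True

end Proc

/-- Global definitions `A(x₀, …, xₖ₋₁) = P`, one for each process name. The parameters are the
indices `0, …, k - 1`, they are exactly the free channels of `P`, and the invocations in `P` are
guarded. -/
structure Program (Tag Name : Type) where
  arity : Name → ℕ
  body : Name → Proc Tag Name
  fn_body : ∀ A, (body A).fn = {x | x < arity A}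
  guarded_body : ∀ A, (body A).Guarded

/-- The body of the definition of `A`, with the parameters replaced by `args`. -/
def Program.unfold {Tag Name : Type} (𝒟 : Program Tag Name) (A : Name) (args : List ℕ) :
    Proc Tag Name :=
  (𝒟.body A).rename (fun i => args.getD i 0)

/-- Buffers. The channel on which the messages are sent is not part of the buffer, it is given
when the hole is filled: `B.fill x P` is `𝓑ₓ[P]`. In `chan P B` the fresh channel is bound in `P`
only, thus holes are not in the scope of any binder. -/
inductive Buf (Tag Name : Type)
  | hole
  | tag (a : Tag) (B : Buf Tag Name)
  | chan (P : Proc Tag Name) (B : Buf Tag Name)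

namespace Buf

variable {Tag Name : Type}

/-- The process obtained by filling the hole of a buffer for the channel `x`. -/
def fill : Buf Tag Name → ℕ → Proc Tag Name → Proc Tag Name
  | hole, _, P => P
  | tag a B, x, P => .select x a (B.fill x P)
  | chan Q B, x, P => .fork x Q (B.fill x P)

/-- Renaming of the free channels of the processes in a buffer. -/
def rename (ρ : ℕ → ℕ) : Buf Tag Name → Buf Tag Name
  | hole => hole
  | tag a B => tag a (B.rename ρ)
  | chan P B => chan (P.rename (lift ρ)) (B.rename ρ)

end Buf

/-! ## Operational semantics -/

/-- Structural precongruence, the smallest precongruence that is closed under the rules below.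
Side conditions of the form `x ∉ fn(–)` are rendered by asking that the process or buffer is in
the image of the renaming that skips `x`. -/
inductive PreCong {Tag Name : Type} (𝒟 : Program Tag Name) :
    Proc Tag Name → Proc Tag Name → Prop
  | refl (P) : PreCong 𝒟 P P
  | trans {P Q R} : PreCong 𝒟 P Q → PreCong 𝒟 Q R → PreCong 𝒟 P R
  | congSelect (x a) {P P'} : PreCong 𝒟 P P' → PreCong 𝒟 (.select x a P) (.select x a P')
  | congFork (x) {P P' Q Q'} : PreCong 𝒟 P P' → PreCong 𝒟 Q Q' →
      PreCong 𝒟 (.fork x P Q) (.fork x P' Q')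
  | congChoice {P P' Q Q'} : PreCong 𝒟 P P' → PreCong 𝒟 Q Q' →
      PreCong 𝒟 (.choice P Q) (.choice P' Q')
  | congWait (x) {P P'} : PreCong 𝒟 P P' → PreCong 𝒟 (.wait x P) (.wait x P')
  | congCase (x D) {P P' : {a // a ∈ D} → Proc Tag Name} : (∀ i, PreCong 𝒟 (P i) (P' i)) →
      PreCong 𝒟 (.case x D P) (.case x D P')
  | congJoin (x) {P P'} : PreCong 𝒟 P P' → PreCong 𝒟 (.join x P) (.join x P')
  | congCut {P P' Q Q'} : PreCong 𝒟 P P' → PreCong 𝒟 Q Q' →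
      PreCong 𝒟 (.cut P Q) (.cut P' Q')
  | call (A args) : args.length = 𝒟.arity A → PreCong 𝒟 (.call A args) (𝒟.unfold A args)
  | link (x y) : PreCong 𝒟 (.link x y) (.link y x)
  | comm (P Q) : PreCong 𝒟 (.cut P Q) (.cut Q P)
  | wait (B : Buf Tag Name) (y P Q) :
      PreCong 𝒟 (.cut (B.fill 0 (.wait (y + 1) P)) Q) (.wait y (.cut (B.fill 0 P) Q))
  | case (B : Buf Tag Name) (y D) (P : {a // a ∈ D} → Proc Tag Name) (Q) :
      PreCong 𝒟 (.cut (B.fill 0 (.case (y + 1) D P)) Q)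
        (.case y D (fun i => .cut (B.fill 0 (P i)) Q))
  | join (B : Buf Tag Name) (y P Q) :
      PreCong 𝒟 (.cut (B.fill 0 (.join (y + 1) P)) Q)
        (.join y (.cut ((B.rename (lift Nat.succ)).fill 0 (P.rename exch))
          (Q.rename (lift Nat.succ))))
  | pull0 (B B' : Buf Tag Name) (y P) :
      PreCong 𝒟 (.cut (B.fill 0 P) (B'.fill 0 (.link 0 (y + 1))))
        ((B.rename (inst y)).fill y (.cut P (B'.fill 0 (.link 0 (y + 1)))))
  | pull1 (y P Q R) : 1 ∈ P.fn →
      PreCong 𝒟 (.cut (.fork (y + 1) P (Q.rename Nat.succ)) R)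
        (.fork y (.cut (P.rename exch) (R.rename (lift Nat.succ))) Q)
  | pull2 (B : Buf Tag Name) (y P Q) :
      PreCong 𝒟 (.cut ((B.rename Nat.succ).fill (y + 1) P) Q) (B.fill y (.cut P Q))
  | pull3 (B : Buf Tag Name) (x y P Q) : x ≠ y → x + 1 ∈ P.fn →
      PreCong 𝒟 (B.fill x (.fork y P Q)) (.fork y ((B.rename Nat.succ).fill (x + 1) P) Q)
  | pull4 (B B' : Buf Tag Name) (x y P) : x ≠ y → x ∈ P.fn →
      PreCong 𝒟 (B.fill x (B'.fill y P)) (B'.fill y (B.fill x P))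

/-- Reduction. -/
inductive Red {Tag Name : Type} (𝒟 : Program Tag Name) : Proc Tag Name → Proc Tag Name → Prop
  | choiceLeft (P Q) : Red 𝒟 (.choice P Q) P
  | choiceRight (P Q) : Red 𝒟 (.choice P Q) Q
  | link (y P) : Red 𝒟 (.cut (.link 0 (y + 1)) P) (P.rename (inst y))
  | close (P) : Red 𝒟 (.cut (.close 0) (.wait 0 (P.rename Nat.succ))) P
  | select (B : Buf Tag Name) (P D Q) (k : {a // a ∈ D}) :
      Red 𝒟 (.cut (.select 0 k.1 P) (B.fill 0 (.case 0 D Q))) (.cut P (B.fill 0 (Q k)))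
  | fork (B : Buf Tag Name) (P Q R) :
      Red 𝒟 (.cut (.fork 0 (P.rename (lift Nat.succ)) Q) (B.fill 0 (.join 0 R)))
        (.cut P (.cut (Q.rename (lift Nat.succ))
          ((B.rename (lift Nat.succ)).fill 0 (R.rename exch))))
  | cut {P Q} (R) : Red 𝒟 P Q → Red 𝒟 (.cut P R) (.cut Q R)
  | buffer (B : Buf Tag Name) (x) {P Q} : Red 𝒟 P Q → Red 𝒟 (B.fill x P) (B.fill x Q)
  | str {P R Q} : PreCong 𝒟 P R → Red 𝒟 R Q → Red 𝒟 P Q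

/-- `P` is deadlock free when every irreducible process that it reduces to is structurally
precongruent to `done`. -/
def DeadlockFree {Tag Name : Type} (𝒟 : Program Tag Name) (P : Proc Tag Name) : Prop :=
  ∀ Q, Relation.ReflTransGen (Red 𝒟) P Q → (¬ ∃ Q', Red 𝒟 Q Q') → PreCong 𝒟 Q .done

/-- Threads: `done`, links, closures and inputs, possibly behind buffers. -/
inductive Thread {Tag Name : Type} : Proc Tag Name → Prop
  | done : Thread .done
  | link (x y) : Thread (.link x y)
  | close (x) : Thread (.close x)
  | wait (x P) : Thread (.wait x P)
  | join (x P) : Thread (.join x P)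
  | case (x D P) : Thread (.case x D P)
  | buffer (B : Buf Tag Name) (x) {P} : Thread P → Thread (B.fill x P)

/-! ## Type system -/

/-- Typing contexts: partial maps from channels to session types. -/
abbrev Ctx (Tag : Type) : Type := ℕ → Option (SType Tag)

namespace Ctx

variable {Tag : Type}

/-- The empty context. -/
def empty : Ctx Tag := fun _ => none

/-- The context `Γ` with the type of `x` set to `S`. -/
def set (Γ : Ctx Tag) (x : ℕ) (S : SType Tag) : Ctx Tag := Function.update Γ x (some S)

/-- The context `Γ` without `x`. -/
def remove (Γ : Ctx Tag) (x : ℕ) : Ctx Tag := Function.update Γ x none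

/-- The context `Γ, y : S` for the scope of a binder of `y`. -/
def bind (Γ : Ctx Tag) (S : SType Tag) : Ctx Tag
  | 0 => some S
  | n + 1 => Γ n

/-- `Γ` is the union `Γ₁, Γ₂` of contexts with disjoint domains. -/
def Split (Γ Γ₁ Γ₂ : Ctx Tag) : Prop :=
  ∀ x, (Γ x = Γ₁ x ∧ Γ₂ x = none) ∨ (Γ x = Γ₂ x ∧ Γ₁ x = none)

end Ctx

/-- One application of a typing rule, with premises in `J`. The judgment `J n P Γ` means that `P`
has measure `n` and is well typed in `Γ`. In the rule `case` the process may handle more tags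
than those in the type. -/
inductive TypingRule {Tag Name : Type} (𝒟 : Program Tag Name)
    (J : ℕ → Proc Tag Name → Ctx Tag → Prop) : ℕ → Proc Tag Name → Ctx Tag → Prop
  | done (n) : TypingRule 𝒟 J n .done Ctx.empty
  | link (n x y S T) : 1 ≤ n → x ≠ y → FairSub S.dual T →
      TypingRule 𝒟 J n (.link x y) ((Ctx.empty.set x S).set y T)
  | call (n m A args Γ) : m ≤ n → args.length = 𝒟.arity A → args.Nodup →
      (∀ x, x ∈ args ↔ Γ x ≠ none) → J m (𝒟.unfold A args) Γ →
      TypingRule 𝒟 J n (.call A args) Γ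
  | choiceLeft (n₁ n₂ P Q Γ) : J n₁ P Γ → J n₂ Q Γ → TypingRule 𝒟 J (1 + n₁) (.choice P Q) Γ
  | choiceRight (n₁ n₂ P Q Γ) : J n₁ P Γ → J n₂ Q Γ → TypingRule 𝒟 J (1 + n₂) (.choice P Q) Γ
  | cut (n₁ n₂ P Q Γ Γ₁ Γ₂ S T) : Ctx.Split Γ Γ₁ Γ₂ → Correct S T →
      J n₁ P (Γ₁.bind S) → J n₂ Q (Γ₂.bind T) → TypingRule 𝒟 J (n₁ + n₂) (.cut P Q) Γ
  | close (n x) : 1 ≤ n → TypingRule 𝒟 J n (.close x) (Ctx.empty.set x (.unit .out))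
  | wait (n x P Γ) : Γ x = some (.unit .inp) → J n P (Γ.remove x) →
      TypingRule 𝒟 J n (.wait x P) Γ
  | select (n x P Γ D hD m S) (k : {a // a ∈ D}) : Γ x = some (.branch .out D hD m S) →
      J n P (Γ.set x (S k)) → TypingRule 𝒟 J (1 + m k + n) (.select x k.1 P) Γ
  | case (n x D P Γ) (m : {a // a ∈ D} → ℕ) (S : {a // a ∈ D} → SType Tag)
      (E : Finset Tag) (hE : E.Nonempty) (hED : ∀ a ∈ E, a ∈ D) :
      Γ x = some (.branch .inp E hE (fun i => m ⟨i.1, hED i.1 i.2⟩)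
        (fun i => S ⟨i.1, hED i.1 i.2⟩)) →
      (∀ i, J (n + m i) (P i) (Γ.set x (S i))) → TypingRule 𝒟 J n (.case x D P) Γ
  | fork (n₁ n₂ x P Q Γ Γ₁ Γ₂ S T) : Γ x = some (.mult .out S T) →
      Ctx.Split (Γ.remove x) Γ₁ Γ₂ → J n₁ P (Γ₁.bind S) → J n₂ Q (Γ₂.set x T) →
      TypingRule 𝒟 J (1 + n₁ + n₂) (.fork x P Q) Γ
  | join (n x P Γ S T) : Γ x = some (.mult .inp S T) → J n P ((Γ.set x T).bind S) →
      TypingRule 𝒟 J n (.join x P) Γ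

/-- `P` is well typed in `Γ` with measure `n`: there is a possibly infinite derivation, that is,
the typing rules are interpreted coinductively. -/
def Typed {Tag Name : Type} (𝒟 : Program Tag Name) (n : ℕ) (P : Proc Tag Name) (Γ : Ctx Tag) :
    Prop :=
  ∃ J : ℕ → Proc Tag Name → Ctx Tag → Prop,
    (∀ m Q Δ, J m Q Δ → TypingRule 𝒟 J m Q Δ) ∧ J n P Γ

/-- `P` is well typed in `Γ`. -/
def WellTyped {Tag Name : Type} (𝒟 : Program Tag Name) (P : Proc Tag Name) (Γ : Ctx Tag) : Prop :=
  ∃ n, Typed 𝒟 n P Γ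

end CaP

/-!
The theorem follows from subject reduction and progress. The given typing rules do not enjoy
subject reduction as they stand: a reduction on a link, or forwarding a buffer through it, replaces
the type of a channel by a subtype, and subtyping is not among the rules. The proof therefore works
with a coarser judgment `Ty`, whose rules `Rule` type the output of a tag or of a channel by any type
that allows the corresponding transition, even beneath some inputs. These rules are closed under
subtyping (`Ty.sub`), and for this reason structural precongruence (`PreCong.ty`) and reduction
(`Red.ty`) preserve typing in the very same context.

Three facts about session types are needed. Correct composition is transitive through a forwarder
(`Correct.trans`), so `S ≤ T` just says that the dual of `T` composes correctly with `S`
(`fairSub_iff`). The inputs of a type are the outputs of its dual, and conversely (`Step.dual`).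
Inputs commute with outputs (`Step.diamond`), and therefore an input that is possible before the
messages in a buffer are sent is still possible when the process behind the buffer is reached
(`BufTy.step_inp`).

Measures serve a single purpose: a process performs only finitely many outputs before its next
input or choice. In `Ty` this is expressed by a greatest fixed point over a least fixed point,
the inner induction going through outputs, compositions and invocations. Well typed processes
satisfy `Ty` because an output decreases the measure and definitions are guarded
(`WellTyped.ty`).

Progress is by induction on the inner layer (`Rule.progress`). The relevant case is a composition
of two threads. Each of them is first rearranged into a normal form with respect to the connecting
channel (`Thread.exists_ready`), from which every action on another channel can be pulled out of
the composition. The threads that remain act on the connecting channel, and correctness of the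
composition excludes that both wait or that they send messages that are not expected
(`progress_cut_core`). In the empty context the only thread is `done`, which gives deadlock
freedom.
-/

namespace CaP

/-! ### Session types as trees -/

@[simp] theorem Pol.flip_flip (p : Pol) : p.flip.flip = p := by cases p <;> rfl

theorem Pol.flip_ne (p : Pol) : p.flip ≠ p := by cases p <;> exact Pol.noConfusion

namespace Tree

variable {Tag : Type}

theorem exists_node (t : Tree Tag) : ∃ a f, t = node a f :=
  ⟨_, _, (PFunctor.M.mk_dest (F := sig Tag) t).symm⟩

theorem node_inj {a b : Shape Tag} {f : a.Arity → Tree Tag} {g : b.Arity → Tree Tag}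
    (h : node a f = node b g) : a = b ∧ HEq f g := by
  have h' : (⟨a, f⟩ : (sig Tag) (Tree Tag)) = ⟨b, g⟩ := PFunctor.M.mk_inj (F := sig Tag) h
  cases h'
  exact ⟨rfl, HEq.rfl⟩

theorem regular_of_node {a : Shape Tag} {f : a.Arity → Tree Tag} (h : (node a f).Regular)
    (i : a.Arity) : (f i).Regular :=
  h.subset fun _ hs => Relation.ReflTransGen.head (b := f i) ⟨i, rfl⟩ hs

theorem dual_mk (t : Tree Tag) :
    t.dual = PFunctor.M.mk (F := sig Tag) ((sig Tag).map dual (dualStep t)) := by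
  rw [← PFunctor.M.mk_dest (F := sig Tag) t.dual]
  exact congrArg _ (PFunctor.M.dest_corec dualStep t)

theorem dual_unit (p : Pol) (f) :
    (node (.unit p : Shape Tag) f).dual = node (.unit p.flip) (fun i => (f i).dual) := by
  rw [dual_mk]; rfl

theorem dual_branch (p : Pol) (D : Finset Tag) (hD m f) :
    (node (.branch p D hD m) f).dual = node (.branch p.flip D hD m) (fun i => (f i).dual) := by
  rw [dual_mk]; rfl

theorem dual_mult (p : Pol) (f) :
    (node (.mult p : Shape Tag) f).dual = node (.mult p.flip) (fun i => (f i).dual) := by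
  rw [dual_mk]; rfl

theorem dual_dual (t : Tree Tag) : t.dual.dual = t := by
  refine PFunctor.M.bisim (P := sig Tag) (fun x y : Tree Tag => x = y.dual.dual) ?_ _ _ rfl
  rintro _ t rfl
  obtain ⟨a, f, rfl⟩ := exists_node t
  cases a with
  | unit p =>
    rw [dual_unit, dual_unit, Pol.flip_flip]
    exact ⟨_, _, _, rfl, rfl, fun _ => rfl⟩
  | branch p D hD m =>
    rw [dual_branch, dual_branch, Pol.flip_flip]
    exact ⟨_, _, _, rfl, rfl, fun _ => rfl⟩
  | mult p =>
    rw [dual_mult, dual_mult, Pol.flip_flip]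
    exact ⟨_, _, _, rfl, rfl, fun _ => rfl⟩

end Tree

namespace SType

variable {Tag : Type}

theorem cases (S : SType Tag) : (∃ p, S = unit p) ∨
    (∃ p D hD m T, S = branch p D hD m T) ∨ ∃ p S₁ S₂, S = mult p S₁ S₂ := by
  obtain ⟨t, ht⟩ := S
  obtain ⟨a, f, rfl⟩ := Tree.exists_node t
  cases a with
  | unit p =>
    refine Or.inl ⟨p, Subtype.ext (congrArg (Tree.node _) ?_)⟩
    funext e
    exact Empty.elim e
  | branch p D hD m =>
    exact Or.inr (Or.inl ⟨p, D, hD, m, fun i => ⟨f i, Tree.regular_of_node ht i⟩, rfl⟩)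
  | mult p =>
    refine Or.inr (Or.inr ⟨p, ⟨f false, Tree.regular_of_node ht false⟩,
      ⟨f true, Tree.regular_of_node ht true⟩, Subtype.ext (congrArg (Tree.node _) ?_)⟩)
    funext b
    cases b <;> rfl

theorem unit_inj {p q : Pol} (h : (unit p : SType Tag) = unit q) : p = q := by
  have := (Tree.node_inj (congrArg Subtype.val h)).1
  cases this
  rfl

theorem branch_inj {p q : Pol} {D E : Finset Tag} {hD hE m m' S S'}
    (h : branch p D hD m S = branch q E hE m' S') : p = q ∧ D = E ∧ HEq m m' ∧ HEq S S' := by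
  obtain ⟨h1, h2⟩ := Tree.node_inj (congrArg Subtype.val h)
  cases h1
  refine ⟨rfl, rfl, HEq.rfl, heq_of_eq (funext fun i => Subtype.ext ?_)⟩
  exact congrFun (eq_of_heq h2) i

theorem mult_inj {p q : Pol} {S T S' T' : SType Tag}
    (h : mult p S T = mult q S' T') : p = q ∧ S = S' ∧ T = T' := by
  obtain ⟨h1, h2⟩ := Tree.node_inj (congrArg Subtype.val h)
  cases h1
  exact ⟨rfl, Subtype.ext (congrFun (eq_of_heq h2) false),
    Subtype.ext (congrFun (eq_of_heq h2) true)⟩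

theorem unit_ne_branch {p q : Pol} {D : Finset Tag} {hD m S} :
    unit p ≠ branch q D hD m S := fun h => by
  cases (Tree.node_inj (congrArg Subtype.val h)).1

theorem unit_ne_mult {p q : Pol} {S T : SType Tag} : unit p ≠ mult q S T := fun h => by
  cases (Tree.node_inj (congrArg Subtype.val h)).1

theorem branch_ne_mult {p q : Pol} {D : Finset Tag} {hD m S} {T T' : SType Tag} :
    branch p D hD m S ≠ mult q T T' := fun h => by
  cases (Tree.node_inj (congrArg Subtype.val h)).1

theorem dual_unit (p : Pol) : (unit p : SType Tag).dual = unit p.flip := by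
  refine Subtype.ext ((Tree.dual_unit p _).trans (congrArg (Tree.node _) ?_))
  funext e
  exact Empty.elim e

theorem dual_branch (p : Pol) (D : Finset Tag) (hD m S) :
    (branch p D hD m S).dual = branch p.flip D hD m (fun i => (S i).dual) :=
  Subtype.ext (Tree.dual_branch p D hD m _)

theorem dual_mult (p : Pol) (S T : SType Tag) :
    (mult p S T).dual = mult p.flip S.dual T.dual := by
  refine Subtype.ext ((Tree.dual_mult p _).trans (congrArg (Tree.node _) ?_))
  funext b
  cases b <;> rfl

@[simp] theorem dual_dual (S : SType Tag) : S.dual.dual = S := Subtype.ext (Tree.dual_dual S.1)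

theorem pos_unit {p : Pol} : (unit p : SType Tag).Pos ↔ p = .out := Iff.rfl

theorem pos_branch {p : Pol} {D : Finset Tag} {hD m S} :
    (branch p D hD m S).Pos ↔ p = .out := Iff.rfl

theorem pos_mult {p : Pol} {S T : SType Tag} : (mult p S T).Pos ↔ p = .out := Iff.rfl

theorem not_pos_dual {S : SType Tag} (h : S.Pos) : ¬ S.dual.Pos := by
  rcases S.cases with ⟨p, rfl⟩ | ⟨p, D, hD, m, T, rfl⟩ | ⟨p, S₁, S₂, rfl⟩
  · rw [dual_unit, pos_unit]; cases (pos_unit.1 h); exact Pol.noConfusion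
  · rw [dual_branch, pos_branch]; cases (pos_branch.1 h); exact Pol.noConfusion
  · rw [dual_mult, pos_mult]; cases (pos_mult.1 h); exact Pol.noConfusion

end SType

/-! ### Transitions -/

section Step

variable {Tag : Type} {p : Pol} {σ : Msg Tag}

theorem Must.unit_inv {q : Pol} {S' : SType Tag} (h : Must p σ (.unit q) S') :
    q = p ∧ σ = .star ∧ S' = .unit p := by
  generalize hS : SType.unit q = S at h
  cases h with
  | unit => exact ⟨SType.unit_inj hS, rfl, rfl⟩
  | branch => exact (SType.unit_ne_branch hS).elim
  | mult => exact (SType.unit_ne_mult hS).elim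

theorem Must.branch_inv {q : Pol} {D : Finset Tag} {hD m S} {S' : SType Tag}
    (h : Must p σ (.branch q D hD m S) S') :
    q = p ∧ ∃ k : {a // a ∈ D}, σ = .tag k.1 (m k) ∧ S' = S k := by
  generalize hS : SType.branch q D hD m S = T at h
  cases h with
  | unit => exact (SType.unit_ne_branch hS.symm).elim
  | branch D' hD' m' S' k =>
    obtain ⟨rfl, rfl, hm, hT⟩ := SType.branch_inj hS
    cases hm; cases hT
    exact ⟨rfl, k, rfl, rfl⟩
  | mult => exact (SType.branch_ne_mult hS).elim

theorem Must.mult_inv {q : Pol} {S T S' : SType Tag} (h : Must p σ (.mult q S T) S') :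
    q = p ∧ σ = .chan S ∧ S' = T := by
  generalize hS : SType.mult q S T = U at h
  cases h with
  | unit => exact (SType.unit_ne_mult hS.symm).elim
  | branch => exact (SType.branch_ne_mult hS.symm).elim
  | mult S₁ T₁ =>
    obtain ⟨rfl, rfl, rfl⟩ := SType.mult_inj hS
    exact ⟨rfl, rfl, rfl⟩

theorem Infer.mono {R R' : SType Tag → SType Tag → Prop} (hR : ∀ S T, R S T → R' S T)
    {S T : SType Tag} (h : Infer p σ R S T) : Infer p σ R' S T := by
  cases h with
  | must h => exact .must h
  | mayBranch D hD m S S' h => exact .mayBranch D hD m S S' fun i => hR _ _ (h i)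
  | mayMult S T T' h => exact .mayMult S T T' (hR _ _ h)

theorem Step.fin {S T : SType Tag} (h : Step p σ S T) : FinStep p σ S T := by
  obtain ⟨R, h1, -, h⟩ := h
  exact h1 _ _ h

theorem Step.infer {S T : SType Tag} (h : Step p σ S T) : Infer p σ (Step p σ) S T := by
  obtain ⟨R, h1, h2, h⟩ := h
  exact (h2 _ _ h).mono fun _ _ h => ⟨R, h1, h2, h⟩

/-- Transitions are closed under the rules. The corule is not involved: a rule whose premises are
finitely derivable has a finitely derivable conclusion. -/
theorem Step.of_infer {S T : SType Tag} (h : Infer p σ (Step p σ) S T) : Step p σ S T := by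
  refine ⟨Infer p σ (Step p σ), ?_, fun _ _ h => h.mono fun _ _ => Step.infer, h⟩
  intro S T h
  cases h with
  | must h => exact .must h
  | mayBranch D hD m S S' h => exact .mayBranch D hD m S S' fun i => (h i).fin
  | mayMult S T T' h => exact .mayMult S T T' h.fin

theorem Must.step {S T : SType Tag} (h : Must p σ S T) : Step p σ S T := .of_infer (.must h)

theorem Step.unit_inv {q : Pol} {S' : SType Tag} (h : Step p σ (.unit q) S') :
    q = p ∧ σ = .star ∧ S' = .unit p := by
  have h := h.infer
  generalize hS : SType.unit q = S at h
  cases h with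
  | must h => subst hS; exact h.unit_inv
  | mayBranch => exact (SType.unit_ne_branch hS).elim
  | mayMult => exact (SType.unit_ne_mult hS).elim

theorem Step.branch_inv {D : Finset Tag} {hD m S} {S' : SType Tag}
    (h : Step p σ (.branch p D hD m S) S') :
    ∃ k : {a // a ∈ D}, σ = .tag k.1 (m k) ∧ S' = S k := by
  have h := h.infer
  generalize hS : SType.branch p D hD m S = T at h
  cases h with
  | must h => subst hS; exact h.branch_inv.2
  | mayBranch => exact (Pol.flip_ne p (SType.branch_inj hS).1.symm).elim
  | mayMult => exact (SType.branch_ne_mult hS).elim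

theorem Step.branch_flip_inv {D : Finset Tag} {hD m S} {S' : SType Tag}
    (h : Step p σ (.branch p.flip D hD m S) S') :
    ∃ T, S' = .branch p.flip D hD m T ∧ ∀ i, Step p σ (S i) (T i) := by
  have h := h.infer
  generalize hS : SType.branch p.flip D hD m S = T at h
  cases h with
  | must h => subst hS; exact (Pol.flip_ne p h.branch_inv.1).elim
  | mayBranch D' hD' m' S₁ T₁ h =>
    obtain ⟨-, rfl, hm, hT⟩ := SType.branch_inj hS
    cases hm; cases hT
    exact ⟨T₁, rfl, h⟩
  | mayMult => exact (SType.branch_ne_mult hS).elim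

theorem Step.mult_inv {S T S' : SType Tag} (h : Step p σ (.mult p S T) S') :
    σ = .chan S ∧ S' = T := by
  have h := h.infer
  generalize hS : SType.mult p S T = U at h
  cases h with
  | must h => subst hS; exact h.mult_inv.2
  | mayBranch => exact (SType.branch_ne_mult hS.symm).elim
  | mayMult => exact (Pol.flip_ne p (SType.mult_inj hS).1.symm).elim

theorem Step.mult_flip_inv {S T S' : SType Tag} (h : Step p σ (.mult p.flip S T) S') :
    ∃ T', S' = .mult p.flip S T' ∧ Step p σ T T' := by
  have h := h.infer
  generalize hS : SType.mult p.flip S T = U at h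
  cases h with
  | must h => subst hS; exact (Pol.flip_ne p h.mult_inv.1).elim
  | mayBranch => exact (SType.branch_ne_mult hS.symm).elim
  | mayMult S₁ T₁ T₁' h =>
    obtain ⟨-, rfl, rfl⟩ := SType.mult_inj hS
    exact ⟨_, rfl, h⟩

/-- Inputs and outputs of a session type commute: an action that is possible now remains
possible after an action of the opposite polarity, and the order of the two is irrelevant. -/
theorem Step.diamond {τ : Msg Tag} {S S₁ S₂ : SType Tag} (h₁ : Step p σ S S₁)
    (h₂ : Step p.flip τ S S₂) : ∃ S', Step p.flip τ S₁ S' ∧ Step p σ S₂ S' := by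
  rcases S.cases with ⟨q, rfl⟩ | ⟨q, D, hD, m, T, rfl⟩ | ⟨q, T₁, T₂, rfl⟩
  · exact (Pol.flip_ne p (h₂.unit_inv.1.symm.trans h₁.unit_inv.1)).elim
  · by_cases hq : q = p
    · subst hq
      obtain ⟨k, rfl, rfl⟩ := h₁.branch_inv
      have e := Pol.flip_flip q
      generalize hr : q.flip = r at *
      subst e
      obtain ⟨U, rfl, hU⟩ := h₂.branch_flip_inv
      exact ⟨U k, hU k, (Must.branch D hD m U k).step⟩
    · have hq : q = p.flip := by cases p <;> cases q <;> first | rfl | exact (hq rfl).elim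
      subst hq
      obtain ⟨U, rfl, hU⟩ := h₁.branch_flip_inv
      obtain ⟨k, rfl, rfl⟩ := h₂.branch_inv
      exact ⟨U k, (Must.branch D hD m U k).step, hU k⟩
  · by_cases hq : q = p
    · subst hq
      obtain ⟨rfl, rfl⟩ := h₁.mult_inv
      have e := Pol.flip_flip q
      generalize hr : q.flip = r at *
      subst e
      obtain ⟨U, rfl, hU⟩ := h₂.mult_flip_inv
      exact ⟨U, hU, (Must.mult T₁ U).step⟩
    · have hq : q = p.flip := by cases p <;> cases q <;> first | rfl | exact (hq rfl).elim
      subst hq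
      obtain ⟨U, rfl, hU⟩ := h₁.mult_flip_inv
      obtain ⟨rfl, rfl⟩ := h₂.mult_inv
      exact ⟨U, (Must.mult T₁ U).step, hU⟩

/-- The dual of a message: the type of an exchanged channel is dualized. -/
def Msg.dual : Msg Tag → Msg Tag
  | .star => .star
  | .tag a m => .tag a m
  | .chan S => .chan S.dual

theorem Msg.FirstOrder.dual_eq (h : σ.FirstOrder) : σ.dual = σ := by
  cases σ <;> first | rfl | exact h.elim

theorem Must.dual {S T : SType Tag} (h : Must p σ S T) :
    Must p.flip σ.dual S.dual T.dual := by
  cases h with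
  | unit => rw [SType.dual_unit]; exact .unit
  | branch D hD m S k => rw [SType.dual_branch]; exact .branch D hD m (fun i => (S i).dual) k
  | mult S T => rw [SType.dual_mult]; exact .mult _ _

theorem FinStep.dual {S T : SType Tag} (h : FinStep p σ S T) :
    FinStep p.flip σ.dual S.dual T.dual := by
  induction h with
  | must h => exact .must h.dual
  | mayBranch D hD m S S' _ ih =>
    rw [SType.dual_branch, SType.dual_branch]
    exact .mayBranch D hD m _ _ ih
  | mayMult S T T' _ ih =>
    rw [SType.dual_mult, SType.dual_mult]
    exact .mayMult _ _ _ ih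
  | fair D hD m S S' k _ ih =>
    rw [SType.dual_branch, SType.dual_branch]
    exact .fair D hD m (fun i => (S i).dual) (fun i => (S' i).dual) k ih

theorem Step.dual {S T : SType Tag} (h : Step p σ S T) :
    Step p.flip σ.dual S.dual T.dual := by
  refine ⟨fun S T => ∃ S₁ T₁, S = S₁.dual ∧ T = T₁.dual ∧ Step p σ S₁ T₁, ?_, ?_,
    ⟨S, T, rfl, rfl, h⟩⟩
  · rintro _ _ ⟨S, T, rfl, rfl, h⟩
    exact h.fin.dual
  · rintro _ _ ⟨S, T, rfl, rfl, h⟩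
    cases h.infer with
    | must h => exact .must h.dual
    | mayBranch D hD m S S' h' =>
      rw [SType.dual_branch, SType.dual_branch]
      exact .mayBranch D hD m _ _ fun i => ⟨_, _, rfl, rfl, h' i⟩
    | mayMult S T T' h' =>
      rw [SType.dual_mult, SType.dual_mult]
      exact .mayMult _ _ _ ⟨_, _, rfl, rfl, h'⟩

/-- A transition of the dual type, read as a transition of the type itself. -/
theorem Step.of_dual {S T : SType Tag} (h : Step p σ S.dual T) :
    Step p.flip σ.dual S T.dual := by
  have := h.dual
  rwa [SType.dual_dual] at this

end Step

/-! ### Correct composition and subtyping -/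

section Correct

variable {Tag : Type}

theorem isCorrectComposition_correct : IsCorrectComposition (Correct (Tag := Tag)) where
  pos := fun ⟨_, hR, h⟩ => hR.pos h
  io := fun ⟨R, hR, h⟩ hσ hs =>
    let ⟨S', h1, h2⟩ := hR.io h hσ hs
    ⟨S', h1, R, hR, h2⟩
  oi := fun ⟨R, hR, h⟩ hσ hs =>
    let ⟨S', h1, h2⟩ := hR.oi h hσ hs
    ⟨S', h1, R, hR, h2⟩
  ios := fun ⟨R, hR, h⟩ hs =>
    let ⟨S₁, S₂, h1, h2, h3⟩ := hR.ios h hs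
    ⟨S₁, S₂, h1, ⟨R, hR, h2⟩, R, hR, h3⟩
  ois := fun ⟨R, hR, h⟩ hs =>
    let ⟨S₁, S₂, h1, h2, h3⟩ := hR.ois h hs
    ⟨S₁, S₂, h1, ⟨R, hR, h2⟩, R, hR, h3⟩

theorem Correct.symm {S T : SType Tag} (h : Correct S T) : Correct T S := by
  obtain ⟨R, hR, h⟩ := h
  refine ⟨fun S T => R T S, ?_, h⟩
  exact {
    pos := fun h => (hR.pos h).symm
    io := fun h => hR.oi h
    oi := fun h => hR.io h
    ios := fun h hs =>
      let ⟨T₁, T₂, h1, h2, h3⟩ := hR.ois h hs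
      ⟨T₁, T₂, h1, h2, h3⟩
    ois := fun h hs =>
      let ⟨T₁, T₂, h1, h2, h3⟩ := hR.ios h hs
      ⟨T₁, T₂, h1, h2, h3⟩ }

theorem Correct.out_inp {S T S' : SType Tag} {σ : Msg Tag} (h : Correct S T)
    (hσ : σ.FirstOrder) (hs : Step .out σ S S') : ∃ T', Step .inp σ T T' ∧ Correct S' T' :=
  isCorrectComposition_correct.oi h hσ hs

theorem Correct.out_inp_chan {S T S₁ S₂ : SType Tag} (h : Correct S T)
    (hs : Step .out (.chan S₁) S S₂) :
    ∃ T₁ T₂, Step .inp (.chan T₁) T T₂ ∧ Correct S₁ T₁ ∧ Correct S₂ T₂ :=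
  isCorrectComposition_correct.ois h hs

/-- A symmetric relation is a correct composition as soon as half of the conditions hold. -/
theorem IsCorrectComposition.of_symm {R : SType Tag → SType Tag → Prop}
    (symm : ∀ {S T}, R S T → R T S) (pos : ∀ {S T}, R S T → S.Pos ∨ T.Pos)
    (oi : ∀ {S T σ S'}, R S T → σ.FirstOrder → Step .out σ S S' →
      ∃ T', Step .inp σ T T' ∧ R S' T')
    (ois : ∀ {S T S₁ S₂}, R S T → Step .out (.chan S₁) S S₂ →
      ∃ T₁ T₂, Step .inp (.chan T₁) T T₂ ∧ R S₁ T₁ ∧ R S₂ T₂) : IsCorrectComposition R where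
  pos := pos
  oi := oi
  ois := ois
  io h hσ hs :=
    let ⟨T', h1, h2⟩ := oi (symm h) hσ hs
    ⟨T', h1, symm h2⟩
  ios h hs :=
    let ⟨T₁, T₂, h1, h2, h3⟩ := ois (symm h) hs
    ⟨T₁, T₂, h1, symm h2, symm h3⟩

theorem correct_dual (S : SType Tag) : Correct S.dual S := by
  refine ⟨fun S T => S = T.dual, .of_symm ?_ ?_ ?_ ?_, rfl⟩
  · rintro _ T rfl
    simp
  · rintro _ T rfl
    rcases T.cases with ⟨p, rfl⟩ | ⟨p, D, hD, m, T, rfl⟩ | ⟨p, S₁, S₂, rfl⟩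
    · rw [SType.dual_unit, SType.pos_unit, SType.pos_unit]; cases p <;> simp [Pol.flip]
    · rw [SType.dual_branch, SType.pos_branch, SType.pos_branch]; cases p <;> simp [Pol.flip]
    · rw [SType.dual_mult, SType.pos_mult, SType.pos_mult]; cases p <;> simp [Pol.flip]
  · rintro _ T σ S' rfl hσ hs
    have := hs.of_dual
    rw [hσ.dual_eq] at this
    exact ⟨_, this, (SType.dual_dual _).symm⟩
  · rintro _ T S₁ S₂ rfl hs
    exact ⟨_, _, hs.of_dual, (SType.dual_dual _).symm, (SType.dual_dual _).symm⟩

/-- Transitivity of correct composition through a forwarder, which behaves as `S` on one side and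
as its dual on the other. -/
theorem Correct.trans {R S T : SType Tag} (h₁ : Correct R S.dual) (h₂ : Correct S T) :
    Correct R T := by
  refine ⟨fun R T => ∃ S, Correct R S.dual ∧ Correct S T, .of_symm ?_ ?_ ?_ ?_, S, h₁, h₂⟩
  · rintro R T ⟨S, h₁, h₂⟩
    exact ⟨S.dual, by simpa using h₂.symm, h₁.symm⟩
  · rintro R T ⟨S, h₁, h₂⟩
    rcases isCorrectComposition_correct.pos h₁ with h | h
    · exact Or.inl h
    · rcases isCorrectComposition_correct.pos h₂ with h' | h'
      · exact (SType.not_pos_dual h' h).elim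
      · exact Or.inr h'
  · rintro R T σ R' ⟨S, h₁, h₂⟩ hσ hs
    obtain ⟨S', hs', h₁'⟩ := h₁.out_inp hσ hs
    have hs' := hs'.of_dual
    rw [hσ.dual_eq] at hs'
    obtain ⟨T', ht, h₂'⟩ := h₂.out_inp hσ hs'
    exact ⟨T', ht, S'.dual, by simpa using h₁', h₂'⟩
  · rintro R T R₁ R₂ ⟨S, h₁, h₂⟩ hs
    obtain ⟨S₁, S₂, hs', h₁', h₁''⟩ := h₁.out_inp_chan hs
    obtain ⟨T₁, T₂, ht, h₂', h₂''⟩ := h₂.out_inp_chan hs'.of_dual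
    exact ⟨T₁, T₂, ht, ⟨S₁.dual, by simpa using h₁', h₂'⟩, S₂.dual, by simpa using h₁'', h₂''⟩

/-- Subtyping is an instance of correct composition. -/
theorem fairSub_iff {S T : SType Tag} : FairSub S T ↔ Correct T.dual S :=
  ⟨fun h => h _ (correct_dual T), fun h _ hR => Correct.trans (by simpa using hR) h⟩

theorem FairSub.refl (S : SType Tag) : FairSub S S := fun _ h => h

theorem FairSub.trans {S T U : SType Tag} (h : FairSub S T) (h' : FairSub T U) : FairSub S U :=
  fun R hR => h R (h' R hR)

theorem FairSub.dual {S T : SType Tag} (h : FairSub S T) : FairSub T.dual S.dual := by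
  rw [fairSub_iff] at *
  simpa using h.symm

theorem FairSub.step_out {S T S' : SType Tag} {σ : Msg Tag} (h : FairSub S T)
    (hσ : σ.FirstOrder) (hs : Step .out σ S S') : ∃ T', Step .out σ T T' ∧ FairSub S' T' := by
  obtain ⟨T', ht, h'⟩ := (fairSub_iff.1 h).symm.out_inp hσ hs
  have ht := ht.of_dual
  rw [hσ.dual_eq] at ht
  exact ⟨_, ht, fairSub_iff.2 (by simpa using h'.symm)⟩

theorem FairSub.step_out_chan {S T S₁ S₂ : SType Tag} (h : FairSub S T)
    (hs : Step .out (.chan S₁) S S₂) :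
    ∃ T₁ T₂, Step .out (.chan T₁) T T₂ ∧ FairSub S₁ T₁ ∧ FairSub S₂ T₂ := by
  obtain ⟨T₁, T₂, ht, h', h''⟩ := (fairSub_iff.1 h).symm.out_inp_chan hs
  exact ⟨_, _, ht.of_dual, fairSub_iff.2 (by simpa using h'.symm),
    fairSub_iff.2 (by simpa using h''.symm)⟩

theorem SType.Pos.cases {S : SType Tag} (h : S.Pos) : S = .unit .out ∨
    (∃ D hD m T, S = .branch .out D hD m T) ∨ ∃ S₁ S₂, S = .mult .out S₁ S₂ := by
  rcases S.cases with ⟨p, rfl⟩ | ⟨p, D, hD, m, T, rfl⟩ | ⟨p, S₁, S₂, rfl⟩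
  · cases SType.pos_unit.1 h; exact Or.inl rfl
  · cases SType.pos_branch.1 h; exact Or.inr (Or.inl ⟨D, hD, m, T, rfl⟩)
  · cases SType.pos_mult.1 h; exact Or.inr (Or.inr ⟨S₁, S₂, rfl⟩)

/-- A partner of `1` is `⊥`, since every other type either performs an output that `1` cannot
input or cannot input the termination signal. -/
theorem Correct.eq_unit_inp {S : SType Tag} (h : Correct S (.unit .out)) : S = .unit .inp := by
  obtain ⟨S', hs, -⟩ := h.symm.out_inp (σ := .star) trivial (Must.unit).step
  rcases S.cases with ⟨p, rfl⟩ | ⟨p, D, hD, m, T, rfl⟩ | ⟨p, S₁, S₂, rfl⟩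
  · rw [hs.unit_inv.1]
  · cases p
    · obtain ⟨a, ha⟩ := hD
      obtain ⟨T', ht, -⟩ := h.out_inp (σ := .tag a (m ⟨a, ha⟩)) trivial
        (Must.branch D ⟨a, ha⟩ m T ⟨a, ha⟩).step
      cases ht.unit_inv.2.1
    · obtain ⟨k, hk, -⟩ := hs.branch_inv
      cases hk
  · cases p
    · obtain ⟨T₁, T₂, ht, -⟩ := h.out_inp_chan (Must.mult S₁ S₂).step
      cases ht.unit_inv.2.1
    · cases hs.mult_inv.1

theorem Correct.eq_unit_out {S : SType Tag} (h : Correct S (.unit .inp)) : S = .unit .out := by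
  have hp : S.Pos := (isCorrectComposition_correct.pos h).resolve_right Pol.noConfusion
  rcases hp.cases with rfl | ⟨D, hD, m, T, rfl⟩ | ⟨S₁, S₂, rfl⟩
  · rfl
  · obtain ⟨a, ha⟩ := hD
    obtain ⟨T', ht, -⟩ := h.out_inp (σ := .tag a (m ⟨a, ha⟩)) trivial
      (Must.branch D ⟨a, ha⟩ m T ⟨a, ha⟩).step
    cases ht.unit_inv.2.1
  · obtain ⟨T₁, T₂, ht, -⟩ := h.out_inp_chan (Must.mult S₁ S₂).step
    cases ht.unit_inv.2.1

theorem FairSub.eq_unit {p : Pol} {S : SType Tag} (h : FairSub (.unit p) S) : S = .unit p := by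
  rw [fairSub_iff] at h
  rw [← SType.dual_dual S]
  cases p
  · rw [h.eq_unit_inp, SType.dual_unit]; rfl
  · rw [h.eq_unit_out, SType.dual_unit]; rfl

theorem FairSub.eq_branch {E : Finset Tag} {hE m} {S : {a // a ∈ E} → SType Tag} {T : SType Tag}
    (h : FairSub (.branch .inp E hE m S) T) : ∃ E' hE' m' S', T = .branch .inp E' hE' m' S' ∧
      ∀ a (ha : a ∈ E'), ∃ ha' : a ∈ E, m ⟨a, ha'⟩ = m' ⟨a, ha⟩ ∧
        FairSub (S ⟨a, ha'⟩) (S' ⟨a, ha⟩) := by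
  rw [fairSub_iff] at h
  have hp : T.dual.Pos := (isCorrectComposition_correct.pos h).resolve_right Pol.noConfusion
  rcases hp.cases with e | ⟨E', hE', m', S', e⟩ | ⟨S₁, S₂, e⟩
  · rw [e] at h
    obtain ⟨T', ht, -⟩ := h.out_inp (σ := .star) trivial (Must.unit).step
    obtain ⟨k, hk, -⟩ := ht.branch_inv
    cases hk
  · refine ⟨E', hE', m', fun i => (S' i).dual, ?_, ?_⟩
    · rw [← SType.dual_dual T, e, SType.dual_branch]; rfl
    · rw [e] at h
      intro a ha
      obtain ⟨T', ht, h'⟩ := h.out_inp (σ := .tag a (m' ⟨a, ha⟩)) trivial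
        (Must.branch E' hE' m' S' ⟨a, ha⟩).step
      obtain ⟨⟨k, hk⟩, e, rfl⟩ := ht.branch_inv
      have ⟨e1, e2⟩ := Msg.tag.inj e
      cases e1
      exact ⟨hk, e2.symm, fairSub_iff.2 (by simpa using h')⟩
  · rw [e] at h
    obtain ⟨T₁, T₂, ht, -⟩ := h.out_inp_chan (Must.mult S₁ S₂).step
    obtain ⟨k, hk, -⟩ := ht.branch_inv
    cases hk

theorem FairSub.eq_mult {S₁ S₂ T : SType Tag} (h : FairSub (.mult .inp S₁ S₂) T) :
    ∃ T₁ T₂, T = .mult .inp T₁ T₂ ∧ FairSub S₁ T₁ ∧ FairSub S₂ T₂ := by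
  rw [fairSub_iff] at h
  have hp : T.dual.Pos := (isCorrectComposition_correct.pos h).resolve_right Pol.noConfusion
  rcases hp.cases with e | ⟨D, hD, m, S', e⟩ | ⟨T₁, T₂, e⟩
  · rw [e] at h
    obtain ⟨T', ht, -⟩ := h.out_inp (σ := .star) trivial (Must.unit).step
    cases ht.mult_inv.1
  · rw [e] at h
    obtain ⟨a, ha⟩ := hD
    obtain ⟨T', ht, -⟩ := h.out_inp (σ := .tag a (m ⟨a, ha⟩)) trivial
      (Must.branch D ⟨a, ha⟩ m S' ⟨a, ha⟩).step
    cases ht.mult_inv.1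
  · refine ⟨T₁.dual, T₂.dual, ?_, ?_⟩
    · rw [← SType.dual_dual T, e, SType.dual_mult]; rfl
    · rw [e] at h
      obtain ⟨U₁, U₂, ht, h', h''⟩ := h.out_inp_chan (Must.mult T₁ T₂).step
      obtain ⟨e, rfl⟩ := ht.mult_inv
      cases e
      exact ⟨fairSub_iff.2 (by simpa using h'), fairSub_iff.2 (by simpa using h'')⟩

end Correct

/-! ### Renaming of channels -/

section Renaming

@[simp] theorem lift_zero (ρ : ℕ → ℕ) : lift ρ 0 = 0 := rfl

@[simp] theorem lift_succ (ρ : ℕ → ℕ) (n : ℕ) : lift ρ (n + 1) = ρ n + 1 := rfl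

@[simp] theorem inst_zero (y : ℕ) : inst y 0 = y := rfl

@[simp] theorem inst_succ (y n : ℕ) : inst y (n + 1) = n := rfl

@[simp] theorem exch_zero : exch 0 = 1 := rfl

@[simp] theorem exch_one : exch 1 = 0 := rfl

@[simp] theorem exch_add_two (n : ℕ) : exch (n + 2) = n + 2 := rfl

theorem exch_exch (n : ℕ) : exch (exch n) = n := by
  rcases n with _ | _ | n <;> rfl

theorem exch_injective : Function.Injective exch :=
  Function.LeftInverse.injective exch_exch

theorem lift_injective {ρ : ℕ → ℕ} (h : Function.Injective ρ) : Function.Injective (lift ρ) := by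
  rintro (_ | x) (_ | y) e
  · rfl
  · simp at e
  · simp at e
  · simp only [lift_succ, Nat.add_right_cancel_iff] at e
    rw [h e]

theorem lift_comp (ρ ρ' : ℕ → ℕ) (n : ℕ) : lift ρ (lift ρ' n) = lift (ρ ∘ ρ') n := by
  cases n <;> rfl

namespace Proc

variable {Tag Name : Type}

theorem rename_congr {P : Proc Tag Name} {ρ ρ' : ℕ → ℕ} (h : ∀ x ∈ P.fn, ρ x = ρ' x) :
    P.rename ρ = P.rename ρ' := by
  have hl : ∀ {P : Proc Tag Name} {ρ ρ' : ℕ → ℕ}, (∀ x, x + 1 ∈ P.fn → ρ x = ρ' x) →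
      ∀ x ∈ P.fn, lift ρ x = lift ρ' x := by
    rintro P ρ ρ' h (_ | x) hx
    · rfl
    · simp [h x hx]
  induction P generalizing ρ ρ' with
  | link x y => simp only [fn, Set.mem_insert_iff, Set.mem_singleton_iff] at h; simp [rename, h]
  | close x => simp only [fn, Set.mem_singleton_iff] at h; simp [rename, h]
  | select x a P ih =>
    simp only [fn, Set.mem_union, Set.mem_singleton_iff] at h
    simp [rename, h, ih fun x hx => h x (Or.inr hx)]
  | fork x P Q ihP ihQ =>
    simp only [fn, Set.mem_union, Set.mem_singleton_iff, Set.mem_ofPred_eq] at h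
    simp [rename, h, ihQ fun x hx => h x (Or.inr hx),
      ihP (hl fun x hx => h x (Or.inl (Or.inr hx)))]
  | choice P Q ihP ihQ =>
    simp only [fn, Set.mem_union] at h
    simp [rename, ihP fun x hx => h x (Or.inl hx), ihQ fun x hx => h x (Or.inr hx)]
  | done => rfl
  | call A args =>
    simp only [fn, Set.mem_ofPred_eq] at h
    simp only [rename, call.injEq, true_and]
    exact List.map_congr_left h
  | wait x P ih =>
    simp only [fn, Set.mem_union, Set.mem_singleton_iff] at h
    simp [rename, h, ih fun x hx => h x (Or.inr hx)]
  | case x D P ih =>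
    simp only [fn, Set.mem_union, Set.mem_singleton_iff, Set.mem_ofPred_eq] at h
    have : ∀ i, (P i).rename ρ = (P i).rename ρ' := fun i =>
      ih i fun x hx => h x (Or.inr ⟨i, hx⟩)
    simp [rename, h, this]
  | join x P ih =>
    simp only [fn, Set.mem_union, Set.mem_singleton_iff, Set.mem_ofPred_eq] at h
    simp [rename, h, ih (hl fun x hx => h x (Or.inr hx))]
  | cut P Q ihP ihQ =>
    simp only [fn, Set.mem_union, Set.mem_ofPred_eq] at h
    simp [rename, ihP (hl fun x hx => h x (Or.inl hx)), ihQ (hl fun x hx => h x (Or.inr hx))]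

theorem rename_rename (P : Proc Tag Name) (ρ ρ' : ℕ → ℕ) :
    (P.rename ρ).rename ρ' = P.rename (ρ' ∘ ρ) := by
  have hl : ∀ ρ ρ' : ℕ → ℕ, lift ρ' ∘ lift ρ = lift (ρ' ∘ ρ) := fun ρ ρ' =>
    funext fun n => lift_comp ρ' ρ n
  induction P generalizing ρ ρ' <;> simp [rename, *]

theorem rename_id (P : Proc Tag Name) : P.rename id = P := by
  have hl : lift id = id := by funext n; cases n <;> rfl
  induction P <;> simp [rename, *]

theorem rename_eq_self {P : Proc Tag Name} {ρ : ℕ → ℕ} (h : ∀ x ∈ P.fn, ρ x = x) :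
    P.rename ρ = P := by
  rw [rename_congr (ρ' := id) h, rename_id]

theorem mem_fn_lift {P : Proc Tag Name} {ρ : ℕ → ℕ}
    (h : ∀ y, y ∈ (P.rename (lift ρ)).fn ↔ ∃ x ∈ P.fn, lift ρ x = y) (y : ℕ) :
    y + 1 ∈ (P.rename (lift ρ)).fn ↔ ∃ x, x + 1 ∈ P.fn ∧ ρ x = y := by
  rw [h]
  constructor
  · rintro ⟨_ | x, hx, e⟩
    · simp at e
    · exact ⟨x, hx, by simpa using e⟩
  · rintro ⟨x, hx, rfl⟩
    exact ⟨x + 1, hx, rfl⟩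

theorem mem_fn_rename {P : Proc Tag Name} {ρ : ℕ → ℕ} {y : ℕ} :
    y ∈ (P.rename ρ).fn ↔ ∃ x ∈ P.fn, ρ x = y := by
  induction P generalizing ρ y with
  | link | close | done | call => simp [rename, fn, eq_comm]
  | select x a P ih | wait x P ih => simp [rename, fn, ih, eq_comm]
  | fork x P Q ihP ihQ =>
    simp only [rename, fn, Set.mem_union, Set.mem_singleton_iff, Set.mem_ofPred_eq,
      mem_fn_lift fun _ => ihP, ihQ]
    grind
  | choice P Q ihP ihQ => simp only [rename, fn, Set.mem_union, ihP, ihQ]; grind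
  | case x D P ih =>
    simp only [rename, fn, Set.mem_union, Set.mem_singleton_iff, Set.mem_ofPred_eq, ih]
    grind
  | join x P ih =>
    simp only [rename, fn, Set.mem_union, Set.mem_singleton_iff, Set.mem_ofPred_eq,
      mem_fn_lift fun _ => ih]
    grind
  | cut P Q ihP ihQ =>
    simp only [rename, fn, Set.mem_union, Set.mem_ofPred_eq,
      mem_fn_lift fun _ => ihP, mem_fn_lift fun _ => ihQ]
    grind

theorem exists_rename {P : Proc Tag Name} {ρ : ℕ → ℕ} (h : ∀ x ∈ P.fn, x ∈ Set.range ρ) :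
    ∃ P' : Proc Tag Name, P = P'.rename ρ := by
  refine ⟨P.rename (Function.invFun ρ), ?_⟩
  rw [rename_rename, rename_eq_self]
  intro x hx
  exact Function.invFun_eq (h x hx)

/-- A process in which the innermost bound channel is not free is a weakening. -/
theorem exists_rename_succ {P : Proc Tag Name} (h : 0 ∉ P.fn) :
    ∃ P' : Proc Tag Name, P = P'.rename Nat.succ := by
  refine exists_rename fun x hx => ?_
  rcases x with _ | x
  · exact (h hx).elim
  · exact ⟨x, rfl⟩

theorem exists_rename_lift_succ {P : Proc Tag Name} (h : 1 ∉ P.fn) :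
    ∃ P' : Proc Tag Name, P = P'.rename (lift Nat.succ) := by
  refine exists_rename fun x hx => ?_
  rcases x with _ | _ | x
  · exact ⟨0, rfl⟩
  · exact (h hx).elim
  · exact ⟨x + 1, rfl⟩

theorem guarded_rename {P : Proc Tag Name} (ρ : ℕ → ℕ) (h : P.Guarded) :
    (P.rename ρ).Guarded := by
  induction P generalizing ρ with
  | cut P Q ihP ihQ => exact ⟨ihP _ h.1, ihQ _ h.2⟩
  | call => exact h
  | _ => trivial

end Proc

variable {Tag Name : Type}

theorem Program.guarded_unfold (𝒟 : Program Tag Name) (A : Name) (args : List ℕ) :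
    (𝒟.unfold A args).Guarded :=
  Proc.guarded_rename _ (𝒟.guarded_body A)

theorem Program.rename_unfold (𝒟 : Program Tag Name) {A : Name} {args : List ℕ} {ρ : ℕ → ℕ}
    (h : args.length = 𝒟.arity A) :
    (𝒟.unfold A args).rename ρ = 𝒟.unfold A (args.map ρ) := by
  rw [unfold, unfold, Proc.rename_rename]
  refine Proc.rename_congr fun x hx => ?_
  rw [𝒟.fn_body, Set.mem_ofPred_eq, ← h] at hx
  simp [hx]

namespace Buf

/-- Concatenation of buffers for the same channel. -/
def append : Buf Tag Name → Buf Tag Name → Buf Tag Name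
  | hole, C => C
  | tag a B, C => tag a (B.append C)
  | chan P B, C => chan P (B.append C)

theorem fill_append (B C : Buf Tag Name) (x : ℕ) (P : Proc Tag Name) :
    (B.append C).fill x P = B.fill x (C.fill x P) := by
  induction B <;> simp [append, fill, *]

theorem mem_fn_fill {B : Buf Tag Name} {x y : ℕ} {P : Proc Tag Name} (h : y ∈ P.fn) :
    y ∈ (B.fill x P).fn := by
  induction B <;> simp [fill, Proc.fn, *]

end Buf

/-! ### Contexts -/

namespace Ctx

variable {Γ Γ' Γ₁ Γ₂ Γ₃ Γ₁₂ : Ctx Tag} {S T : SType Tag} {x y : ℕ} {ρ : ℕ → ℕ}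

@[simp] theorem empty_apply : (empty : Ctx Tag) x = none := rfl

@[simp] theorem bind_zero : Γ.bind S 0 = some S := rfl

@[simp] theorem bind_succ : Γ.bind S (x + 1) = Γ x := rfl

@[grind =] theorem set_apply : Γ.set x S y = if y = x then some S else Γ y := by
  simp [set, Function.update_apply]

@[grind =] theorem remove_apply : Γ.remove x y = if y = x then none else Γ y := by
  simp [remove, Function.update_apply]

theorem bind_set : (Γ.set x T).bind S = (Γ.bind S).set (x + 1) T := by
  funext n; cases n <;> simp [set_apply]

theorem bind_set_zero : (Γ.bind S).set 0 T = Γ.bind T := by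
  funext n; cases n <;> simp [set_apply]

theorem bind_remove : (Γ.remove x).bind S = (Γ.bind S).remove (x + 1) := by
  funext n; cases n <;> simp [remove_apply]

theorem Split.symm (h : Split Γ Γ₁ Γ₂) : Split Γ Γ₂ Γ₁ := fun x => (h x).symm

theorem split_empty : Split Γ empty Γ := fun _ => Or.inr ⟨rfl, rfl⟩

theorem Split.assoc (h : Split Γ Γ₁₂ Γ₃) (h' : Split Γ₁₂ Γ₁ Γ₂) :
    ∃ Γ₂₃, Split Γ Γ₁ Γ₂₃ ∧ Split Γ₂₃ Γ₂ Γ₃ := by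
  refine ⟨fun x => if Γ₁ x = none then Γ x else none, fun x => ?_, fun x => ?_⟩ <;>
  · have := h x; have := h' x
    grind

theorem Split.eq_left (h : Split Γ Γ₁ Γ₂) (hx : Γ₁ x = some S) : Γ x = some S := by
  have := h x; grind

theorem Split.eq_none (h : Split Γ Γ₁ Γ₂) (hx : Γ x = none) : Γ₁ x = none ∧ Γ₂ x = none := by
  have := h x; grind

theorem Split.right_eq_none (h : Split Γ Γ₁ Γ₂) (hx : Γ₁ x = some S) : Γ₂ x = none := by
  have := h x; grind

theorem Split.remove_left (h : Split Γ Γ₁ Γ₂) (hx : Γ₁ x = some S) :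
    Split (Γ.remove x) (Γ₁.remove x) Γ₂ := by
  intro z; have := h z; grind

theorem Split.set_left (h : Split Γ Γ₁ Γ₂) (hx : Γ₁ x = some S) :
    Split (Γ.set x T) (Γ₁.set x T) Γ₂ := by
  intro z; have := h z; grind

/-- `Γ'` is the image of `Γ` along `ρ`, which is injective on the domain of `Γ`. -/
structure Renames (ρ : ℕ → ℕ) (Γ Γ' : Ctx Tag) : Prop where
  map : ∀ x, Γ x ≠ none → Γ' (ρ x) = Γ x
  back : ∀ y, Γ' y ≠ none → ∃ x, Γ x ≠ none ∧ ρ x = y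
  inj : ∀ x x', Γ x ≠ none → Γ x' ≠ none → ρ x = ρ x' → x = x'

theorem Renames.map_some (h : Renames ρ Γ Γ') (hx : Γ x = some S) : Γ' (ρ x) = some S := by
  rw [h.map x (by simp [hx]), hx]

theorem Renames.bind (h : Renames ρ Γ Γ') (S : SType Tag) :
    Renames (lift ρ) (Γ.bind S) (Γ'.bind S) where
  map := by
    rintro (_ | x) hx
    · rfl
    · exact h.map x hx
  back := by
    rintro (_ | y) hy
    · exact ⟨0, by simp, rfl⟩
    · obtain ⟨x, hx, rfl⟩ := h.back y hy
      exact ⟨x + 1, hx, rfl⟩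
  inj := by
    rintro (_ | x) (_ | x') hx hx' e
    · rfl
    · simp at e
    · simp at e
    · simp only [lift_succ, Nat.add_right_cancel_iff] at e
      rw [h.inj x x' hx hx' e]

theorem Renames.eq_empty (h : Renames ρ Ctx.empty Γ') : Γ' = Ctx.empty := by
  funext y
  by_contra hy
  obtain ⟨x, hx, -⟩ := h.back y hy
  exact hx rfl

theorem Renames.remove (h : Renames ρ Γ Γ') (hx : Γ x = some S) :
    Renames ρ (Γ.remove x) (Γ'.remove (ρ x)) := by
  obtain ⟨h1, h2, h3⟩ := h
  constructor <;> grind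

/-- Renaming of an updated context. The condition says that the updated channel does not
clash with the other ones. -/
theorem Renames.set (h : Renames ρ Γ Γ') (hx : ∀ z, Γ z ≠ none → ρ z = ρ x → z = x) :
    Renames ρ (Γ.set x S) (Γ'.set (ρ x) S) := by
  obtain ⟨h1, h2, h3⟩ := h
  constructor <;> grind

theorem Renames.set_of_some (h : Renames ρ Γ Γ') (hx : Γ x = some T) :
    Renames ρ (Γ.set x S) (Γ'.set (ρ x) S) :=
  h.set fun z hz e => h.inj z x hz (by simp [hx]) e

theorem Renames.split (h : Renames ρ Γ Γ') (hs : Split Γ Γ₁ Γ₂) :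
    ∃ Γ₁' Γ₂', Split Γ' Γ₁' Γ₂' ∧ Renames ρ Γ₁ Γ₁' ∧ Renames ρ Γ₂ Γ₂' := by
  classical
  obtain ⟨h1, h2, h3⟩ := h
  refine ⟨fun y => if ∃ x, Γ₁ x ≠ none ∧ ρ x = y then Γ' y else none,
    fun y => if ∃ x, Γ₂ x ≠ none ∧ ρ x = y then Γ' y else none, ?_, ?_, ?_⟩
  · intro y
    by_cases hy : Γ' y = none
    · simp [hy]
    · obtain ⟨x, hx, rfl⟩ := h2 y hy
      have h12 : ∀ z, ρ z = ρ x → Γ z ≠ none → z = x := fun z e hz => h3 z x hz hx e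
      rcases hs x with ⟨e1, e2⟩ | ⟨e1, e2⟩
      · refine Or.inl ⟨(if_pos ⟨x, e1 ▸ hx, rfl⟩).symm, if_neg ?_⟩
        rintro ⟨z, hz, e⟩
        have := h12 z e (by have := hs z; grind)
        grind
      · refine Or.inr ⟨(if_pos ⟨x, e1 ▸ hx, rfl⟩).symm, if_neg ?_⟩
        rintro ⟨z, hz, e⟩
        have := h12 z e (by have := hs z; grind)
        grind
  · constructor
    · intro x hx
      have := hs x
      rw [if_pos ⟨x, hx, rfl⟩]
      grind
    · intro y hy
      by_contra hn
      exact hy (if_neg hn)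
    · intro x x' hx hx'
      have := hs x; have := hs x'
      exact h3 x x' (by grind) (by grind)
  · constructor
    · intro x hx
      have := hs x
      rw [if_pos ⟨x, hx, rfl⟩]
      grind
    · intro y hy
      by_contra hn
      exact hy (if_neg hn)
    · intro x x' hx hx'
      have := hs x; have := hs x'
      exact h3 x x' (by grind) (by grind)

end Ctx

end Renaming

/-! ### Subtyping of contexts -/

section Typing

variable {Tag Name : Type}

namespace Ctx

variable {Γ Δ Γ₁ Γ₂ : Ctx Tag} {S T : SType Tag} {x : ℕ}

/-- Pointwise subtyping of contexts with the same domain. -/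
def Sub (Γ Δ : Ctx Tag) : Prop :=
  ∀ x, (Γ x = none ∧ Δ x = none) ∨ ∃ S T, Γ x = some S ∧ Δ x = some T ∧ FairSub S T

theorem Sub.refl (Γ : Ctx Tag) : Sub Γ Γ := fun x => by
  cases h : Γ x with
  | none => exact Or.inl ⟨rfl, rfl⟩
  | some S => exact Or.inr ⟨S, S, rfl, rfl, .refl S⟩

theorem Sub.eq_some (h : Sub Γ Δ) (hx : Γ x = some S) : ∃ T, Δ x = some T ∧ FairSub S T := by
  rcases h x with ⟨h, -⟩ | ⟨S', T, h1, h2, h3⟩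
  · rw [hx] at h; cases h
  · rw [hx] at h1; cases h1; exact ⟨T, h2, h3⟩

theorem Sub.ne_none (h : Sub Γ Δ) : Γ x ≠ none ↔ Δ x ≠ none := by
  rcases h x with ⟨h1, h2⟩ | ⟨S', T, h1, h2, h3⟩ <;> simp [h1, h2]

theorem Sub.bind (h : Sub Γ Δ) (hS : FairSub S T) : Sub (Γ.bind S) (Δ.bind T) := by
  rintro (_ | x)
  · exact Or.inr ⟨S, T, rfl, rfl, hS⟩
  · exact h x

theorem Sub.remove (h : Sub Γ Δ) : Sub (Γ.remove x) (Δ.remove x) := by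
  intro z
  have := h z
  by_cases hz : z = x
  · simp [remove_apply, hz]
  · simpa [remove_apply, hz] using this

theorem Sub.set (h : Sub Γ Δ) (hS : FairSub S T) : Sub (Γ.set x S) (Δ.set x T) := by
  intro z
  have := h z
  by_cases hz : z = x
  · exact Or.inr ⟨S, T, by simp [set_apply, hz], by simp [set_apply, hz], hS⟩
  · simpa [set_apply, hz] using this

theorem Sub.split (h : Sub Γ Δ) (hs : Split Γ Γ₁ Γ₂) :
    ∃ Δ₁ Δ₂, Split Δ Δ₁ Δ₂ ∧ Sub Γ₁ Δ₁ ∧ Sub Γ₂ Δ₂ := by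
  refine ⟨fun x => if Γ₁ x = none then none else Δ x, fun x => if Γ₂ x = none then none else Δ x,
    fun x => ?_, fun x => ?_, fun x => ?_⟩ <;>
  · have := h x; have := hs x
    grind

end Ctx

/-! ### Asynchronous typing -/

/-- One layer of the typing rules on which the proof is based. Compared to the original rules,
there are no measures, and the rules for the output of tags and channels look at the type of the
channel through its transitions. Thus an output may be typed by any type that allows it, possibly
beneath some inputs, and the rules are closed under subtyping.

The premises in the predicate `X` are those guarded by an input or by a choice, and the forked
processes. All the others are recursive, so that an inductive derivation accounts for all the
outputs that a process performs right away. In the rule `case`, a branch that the type does not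
mention may give any type `T` to the channel. -/
inductive Rule (𝒟 : Program Tag Name) (X : Proc Tag Name → Ctx Tag → Prop) :
    Proc Tag Name → Ctx Tag → Prop
  | done : Rule 𝒟 X .done Ctx.empty
  | link (x y S T) : x ≠ y → FairSub S.dual T →
      Rule 𝒟 X (.link x y) ((Ctx.empty.set x S).set y T)
  | call (A args Γ) : args.length = 𝒟.arity A → args.Nodup → (∀ x, x ∈ args ↔ Γ x ≠ none) →
      Rule 𝒟 X (𝒟.unfold A args) Γ → Rule 𝒟 X (.call A args) Γ
  | choice (P Q Γ) : X P Γ → X Q Γ → Rule 𝒟 X (.choice P Q) Γ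
  | cut (P Q Γ Γ₁ Γ₂ S T) : Ctx.Split Γ Γ₁ Γ₂ → Correct S T → Rule 𝒟 X P (Γ₁.bind S) →
      Rule 𝒟 X Q (Γ₂.bind T) → Rule 𝒟 X (.cut P Q) Γ
  | close (x) : Rule 𝒟 X (.close x) (Ctx.empty.set x (.unit .out))
  | wait (x P Γ) : Γ x = some (.unit .inp) → X P (Γ.remove x) → Rule 𝒟 X (.wait x P) Γ
  | select (x a m P Γ U V) : Γ x = some U → Step .out (.tag a m) U V →
      Rule 𝒟 X P (Γ.set x V) → Rule 𝒟 X (.select x a P) Γ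
  | case (x D P Γ E hE m S) : Γ x = some (.branch .inp E hE m S) → (∀ a ∈ E, a ∈ D) →
      (∀ i : {a // a ∈ D}, ∃ T, (∀ h : i.1 ∈ E, T = S ⟨i.1, h⟩) ∧ X (P i) (Γ.set x T)) →
      Rule 𝒟 X (.case x D P) Γ
  | fork (x P Q Γ Γ₁ Γ₂ U S V) : Γ x = some U → Step .out (.chan S) U V →
      Ctx.Split (Γ.remove x) Γ₁ Γ₂ → X P (Γ₁.bind S) → Rule 𝒟 X Q (Γ₂.set x V) →
      Rule 𝒟 X (.fork x P Q) Γ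
  | join (x P Γ S T) : Γ x = some (.mult .inp S T) → X P ((Γ.set x T).bind S) →
      Rule 𝒟 X (.join x P) Γ

/-- Asynchronous typing, the largest predicate that is consistent with `Rule`. -/
def Ty (𝒟 : Program Tag Name) (P : Proc Tag Name) (Γ : Ctx Tag) : Prop :=
  ∃ X : Proc Tag Name → Ctx Tag → Prop, (∀ P Γ, X P Γ → Rule 𝒟 X P Γ) ∧ X P Γ

variable {𝒟 : Program Tag Name} {P Q R : Proc Tag Name} {Γ Δ : Ctx Tag} {x y : ℕ}

theorem Rule.mono {X Y : Proc Tag Name → Ctx Tag → Prop} (hXY : ∀ P Γ, X P Γ → Y P Γ)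
    (h : Rule 𝒟 X P Γ) : Rule 𝒟 Y P Γ := by
  induction h with
  | done => exact .done
  | link x y S T h h' => exact .link x y S T h h'
  | call A args Γ h1 h2 h3 _ ih => exact .call A args Γ h1 h2 h3 ih
  | choice P Q Γ h1 h2 => exact .choice P Q Γ (hXY _ _ h1) (hXY _ _ h2)
  | cut P Q Γ Γ₁ Γ₂ S T h1 h2 _ _ ih1 ih2 => exact .cut P Q Γ Γ₁ Γ₂ S T h1 h2 ih1 ih2
  | close x => exact .close x
  | wait x P Γ h1 h2 => exact .wait x P Γ h1 (hXY _ _ h2)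
  | select x a m P Γ U V h1 h2 _ ih => exact .select x a m P Γ U V h1 h2 ih
  | case x D P Γ E hE m S h1 h2 h3 =>
    refine .case x D P Γ E hE m S h1 h2 fun i => ?_
    obtain ⟨T, h, h'⟩ := h3 i
    exact ⟨T, h, hXY _ _ h'⟩
  | fork x P Q Γ Γ₁ Γ₂ U S V h1 h2 h3 h4 _ ih =>
    exact .fork x P Q Γ Γ₁ Γ₂ U S V h1 h2 h3 (hXY _ _ h4) ih
  | join x P Γ S T h1 h2 => exact .join x P Γ S T h1 (hXY _ _ h2)

theorem Ty.rule (h : Ty 𝒟 P Γ) : Rule 𝒟 (Ty 𝒟) P Γ := by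
  obtain ⟨X, hX, h⟩ := h
  exact (hX _ _ h).mono fun _ _ h => ⟨X, hX, h⟩

theorem Rule.ty (h : Rule 𝒟 (Ty 𝒟) P Γ) : Ty 𝒟 P Γ :=
  ⟨Rule 𝒟 (Ty 𝒟), fun _ _ h => h.mono fun _ _ => Ty.rule, h⟩

theorem Ty.done_inv (h : Ty 𝒟 .done Γ) : Γ = Ctx.empty := by
  cases h.rule; rfl

theorem Ty.link_inv (h : Ty 𝒟 (.link x y) Γ) : x ≠ y ∧ ∃ S T, FairSub S.dual T ∧
    Γ = (Ctx.empty.set x S).set y T := by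
  cases h.rule with
  | link _ _ S T h1 h2 => exact ⟨h1, S, T, h2, rfl⟩

theorem Ty.call_inv {A : Name} {args : List ℕ} (h : Ty 𝒟 (.call A args) Γ) :
    args.length = 𝒟.arity A ∧ args.Nodup ∧ (∀ x, x ∈ args ↔ Γ x ≠ none) ∧
      Ty 𝒟 (𝒟.unfold A args) Γ := by
  cases h.rule with
  | call _ _ _ h1 h2 h3 h4 => exact ⟨h1, h2, h3, h4.ty⟩

theorem Ty.choice_inv (h : Ty 𝒟 (.choice P Q) Γ) : Ty 𝒟 P Γ ∧ Ty 𝒟 Q Γ := by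
  cases h.rule with
  | choice _ _ _ h1 h2 => exact ⟨h1, h2⟩

theorem Ty.cut_inv (h : Ty 𝒟 (.cut P Q) Γ) : ∃ Γ₁ Γ₂ S T, Ctx.Split Γ Γ₁ Γ₂ ∧ Correct S T ∧
    Ty 𝒟 P (Γ₁.bind S) ∧ Ty 𝒟 Q (Γ₂.bind T) := by
  cases h.rule with
  | cut _ _ _ Γ₁ Γ₂ S T h1 h2 h3 h4 => exact ⟨Γ₁, Γ₂, S, T, h1, h2, h3.ty, h4.ty⟩

theorem Ty.close_inv (h : Ty 𝒟 (.close x) Γ) : Γ = Ctx.empty.set x (.unit .out) := by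
  cases h.rule; rfl

theorem Ty.wait_inv (h : Ty 𝒟 (.wait x P) Γ) :
    Γ x = some (.unit .inp) ∧ Ty 𝒟 P (Γ.remove x) := by
  cases h.rule with
  | wait _ _ _ h1 h2 => exact ⟨h1, h2⟩

theorem Ty.select_inv {a : Tag} (h : Ty 𝒟 (.select x a P) Γ) :
    ∃ m U V, Γ x = some U ∧ Step .out (.tag a m) U V ∧ Ty 𝒟 P (Γ.set x V) := by
  cases h.rule with
  | select _ _ m _ _ U V h1 h2 h3 => exact ⟨m, U, V, h1, h2, h3.ty⟩

theorem Ty.case_inv {D : Finset Tag} {P : {a // a ∈ D} → Proc Tag Name}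
    (h : Ty 𝒟 (.case x D P) Γ) : ∃ E hE m S, Γ x = some (.branch .inp E hE m S) ∧
      (∀ a ∈ E, a ∈ D) ∧
      ∀ i : {a // a ∈ D}, ∃ T, (∀ h : i.1 ∈ E, T = S ⟨i.1, h⟩) ∧ Ty 𝒟 (P i) (Γ.set x T) := by
  cases h.rule with
  | case _ _ _ _ E hE m S h1 h2 h3 => exact ⟨E, hE, m, S, h1, h2, h3⟩

theorem Ty.fork_inv (h : Ty 𝒟 (.fork x P Q) Γ) : ∃ Γ₁ Γ₂ U S V, Γ x = some U ∧
    Step .out (.chan S) U V ∧ Ctx.Split (Γ.remove x) Γ₁ Γ₂ ∧ Ty 𝒟 P (Γ₁.bind S) ∧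
      Ty 𝒟 Q (Γ₂.set x V) := by
  cases h.rule with
  | fork _ _ _ _ Γ₁ Γ₂ U S V h1 h2 h3 h4 h5 => exact ⟨Γ₁, Γ₂, U, S, V, h1, h2, h3, h4, h5.ty⟩

theorem Ty.join_inv (h : Ty 𝒟 (.join x P) Γ) : ∃ S T, Γ x = some (.mult .inp S T) ∧
    Ty 𝒟 P ((Γ.set x T).bind S) := by
  cases h.rule with
  | join _ _ _ S T h1 h2 => exact ⟨S, T, h1, h2⟩

/-- The domain of the context is the set of free channels. -/
theorem Ty.mem_fn (h : Ty 𝒟 P Γ) : x ∈ P.fn ↔ Γ x ≠ none := by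
  induction P generalizing Γ x with
  | link y z =>
    obtain ⟨-, S, T, -, rfl⟩ := h.link_inv
    simp only [Proc.fn, Set.mem_insert_iff, Set.mem_singleton_iff]
    grind [Ctx.empty_apply]
  | close y =>
    rw [h.close_inv]
    simp only [Proc.fn, Set.mem_singleton_iff]
    grind [Ctx.empty_apply]
  | select y a P ih =>
    obtain ⟨m, U, V, h1, -, h2⟩ := h.select_inv
    simp only [Proc.fn, Set.mem_union, Set.mem_singleton_iff, ih h2]
    grind
  | fork y P Q ihP ihQ =>
    obtain ⟨Γ₁, Γ₂, U, S, V, h1, -, h2, h3, h4⟩ := h.fork_inv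
    simp only [Proc.fn, Set.mem_union, Set.mem_singleton_iff, Set.mem_ofPred_eq, ihP h3, ihQ h4,
      Ctx.bind_succ]
    have := h2 x
    grind
  | choice P Q ihP ihQ =>
    simp [Proc.fn, ihP h.choice_inv.1, ihQ h.choice_inv.2]
  | done => simp [h.done_inv, Proc.fn]
  | call A args => exact h.call_inv.2.2.1 x
  | wait y P ih =>
    obtain ⟨h1, h2⟩ := h.wait_inv
    simp only [Proc.fn, Set.mem_union, Set.mem_singleton_iff, ih h2]
    grind
  | case y D P ih =>
    obtain ⟨E, ⟨a, ha⟩, m, S, h1, h2, h3⟩ := h.case_inv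
    simp only [Proc.fn, Set.mem_union, Set.mem_singleton_iff, Set.mem_ofPred_eq]
    constructor
    · rintro (rfl | ⟨i, hi⟩)
      · simp [h1]
      · obtain ⟨T, -, hT⟩ := h3 i
        rw [ih i hT] at hi
        grind
    · intro hx
      obtain ⟨T, -, hT⟩ := h3 ⟨a, h2 a ha⟩
      by_cases hxy : x = y
      · exact Or.inl hxy
      · exact Or.inr ⟨⟨a, h2 a ha⟩, (ih _ hT).2 (by grind)⟩
  | join y P ih =>
    obtain ⟨S, T, h1, h2⟩ := h.join_inv
    simp only [Proc.fn, Set.mem_union, Set.mem_singleton_iff, Set.mem_ofPred_eq, ih h2,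
      Ctx.bind_succ]
    grind
  | cut P Q ihP ihQ =>
    obtain ⟨Γ₁, Γ₂, S, T, h1, -, h3, h4⟩ := h.cut_inv
    simp only [Proc.fn, Set.mem_union, Set.mem_ofPred_eq, ihP h3, ihQ h4, Ctx.bind_succ]
    have := h1 x
    grind

theorem Ty.rename {ρ : ℕ → ℕ} (h : Ty 𝒟 P Γ) (hρ : Ctx.Renames ρ Γ Δ) :
    Ty 𝒟 (P.rename ρ) Δ := by
  refine ⟨fun P' Γ' => ∃ P ρ Γ, P' = P.rename ρ ∧ Ctx.Renames ρ Γ Γ' ∧ Ty 𝒟 P Γ, ?_,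
    P, ρ, Γ, rfl, hρ, h⟩
  rintro _ Γ' ⟨P, ρ, Γ, rfl, hρ, h⟩
  replace h := h.rule
  induction h generalizing ρ Γ' with
  | done => rw [hρ.eq_empty]; exact .done
  | link x y S T hxy hST =>
    have e : Γ' = (Ctx.empty.set (ρ x) S).set (ρ y) T := by
      have h1 := hρ.map x (by grind)
      have h2 := hρ.map y (by grind)
      funext z
      have h3 := hρ.back z
      grind [Ctx.empty_apply]
    rw [e]
    exact .link _ _ _ _ (fun e => hxy (hρ.inj x y (by grind) (by grind) e)) hST
  | call A args Γ h1 h2 h3 _ ih =>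
    refine .call A _ _ (by simpa using h1) ?_ ?_ ?_
    · exact h2.map_on fun x hx y hy e => hρ.inj x y ((h3 x).1 hx) ((h3 y).1 hy) e
    · intro y
      rw [List.mem_map]
      constructor
      · rintro ⟨x, hx, rfl⟩
        rw [hρ.map x ((h3 x).1 hx)]
        exact (h3 x).1 hx
      · intro hy
        obtain ⟨x, hx, e⟩ := hρ.back y hy
        exact ⟨x, (h3 x).2 hx, e⟩
    · rw [← 𝒟.rename_unfold h1]
      exact ih _ _ hρ
  | choice P Q Γ h1 h2 => exact .choice _ _ _ ⟨_, _, _, rfl, hρ, h1⟩ ⟨_, _, _, rfl, hρ, h2⟩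
  | cut P Q Γ Γ₁ Γ₂ S T h1 h2 _ _ ih1 ih2 =>
    obtain ⟨Γ₁', Γ₂', h', e1, e2⟩ := hρ.split h1
    exact .cut _ _ _ _ _ S T h' h2 (ih1 _ _ (e1.bind S)) (ih2 _ _ (e2.bind T))
  | close x =>
    have e : Γ' = Ctx.empty.set (ρ x) (.unit .out) := by
      have h1 := hρ.map x (by grind)
      funext z
      have h3 := hρ.back z
      grind [Ctx.empty_apply]
    rw [e]
    exact .close _
  | wait x P Γ h1 h2 => exact .wait _ _ _ (hρ.map_some h1) ⟨_, _, _, rfl, hρ.remove h1, h2⟩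
  | select x a m P Γ U V h1 h2 _ ih =>
    exact .select _ a m _ _ U V (hρ.map_some h1) h2 (ih _ _ (hρ.set_of_some h1))
  | case x D P Γ E hE m S h1 h2 h3 =>
    refine .case _ D _ _ E hE m S (hρ.map_some h1) h2 fun i => ?_
    obtain ⟨T, hT, h'⟩ := h3 i
    exact ⟨T, hT, _, _, _, rfl, hρ.set_of_some h1, h'⟩
  | fork x P Q Γ Γ₁ Γ₂ U S V h1 h2 h3 h4 _ ih =>
    obtain ⟨Γ₁', Γ₂', h', e1, e2⟩ := (hρ.remove h1).split h3
    refine .fork _ _ _ _ _ _ U S V (hρ.map_some h1) h2 h' ⟨_, _, _, rfl, e1.bind S, h4⟩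
      (ih _ _ (e2.set ?_))
    intro z hz e
    have := h3 z
    exact hρ.inj z x (by grind) (by grind) e
  | join x P Γ S T h1 h2 =>
    exact .join _ _ _ S T (hρ.map_some h1) ⟨_, _, _, rfl, (hρ.set_of_some h1).bind S, h2⟩

/-- Subsumption is admissible. -/
theorem Ty.sub (h : Ty 𝒟 P Γ) (hs : Ctx.Sub Γ Δ) : Ty 𝒟 P Δ := by
  refine ⟨fun P Δ => ∃ Γ, Ctx.Sub Γ Δ ∧ Ty 𝒟 P Γ, ?_, Γ, hs, h⟩
  rintro P Δ ⟨Γ, hs, h⟩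
  replace h := h.rule
  induction h generalizing Δ with
  | done =>
    have : Δ = Ctx.empty := by
      funext z
      have := hs.ne_none (x := z)
      grind [Ctx.empty_apply]
    rw [this]
    exact .done
  | link x y S T hxy hST =>
    obtain ⟨T', e2, hT⟩ := hs.eq_some (x := y) (S := T) (by grind)
    obtain ⟨S', e1, hS⟩ := hs.eq_some (x := x) (S := S) (by grind)
    have : Δ = (Ctx.empty.set x S').set y T' := by
      funext z
      have := hs.ne_none (x := z)
      grind [Ctx.empty_apply]
    rw [this]
    exact .link x y S' T' hxy (hS.dual.trans (hST.trans hT))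
  | call A args Γ h1 h2 h3 _ ih =>
    exact .call A args Δ h1 h2 (fun x => (h3 x).trans hs.ne_none) (ih _ hs)
  | choice P Q Γ h1 h2 => exact .choice _ _ _ ⟨_, hs, h1⟩ ⟨_, hs, h2⟩
  | cut P Q Γ Γ₁ Γ₂ S T h1 h2 _ _ ih1 ih2 =>
    obtain ⟨Δ₁, Δ₂, h', e1, e2⟩ := hs.split h1
    exact .cut _ _ _ _ _ S T h' h2 (ih1 _ (e1.bind (.refl S))) (ih2 _ (e2.bind (.refl T)))
  | close x =>
    obtain ⟨T, e, hT⟩ := hs.eq_some (x := x) (S := .unit .out) (by grind)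
    have : Δ = Ctx.empty.set x (.unit .out) := by
      rw [hT.eq_unit] at e
      funext z
      have := hs.ne_none (x := z)
      grind [Ctx.empty_apply]
    rw [this]
    exact .close x
  | wait x P Γ h1 h2 =>
    obtain ⟨T, e, hT⟩ := hs.eq_some h1
    rw [hT.eq_unit] at e
    exact .wait x P Δ e ⟨_, hs.remove, h2⟩
  | select x a m P Γ U V h1 h2 _ ih =>
    obtain ⟨U', e, hU⟩ := hs.eq_some h1
    obtain ⟨V', h2', hV⟩ := hU.step_out (σ := .tag a m) trivial h2
    exact .select x a m P Δ U' V' e h2' (ih _ (hs.set hV))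
  | case x D P Γ E hE m S h1 h2 h3 =>
    obtain ⟨U', e, hU⟩ := hs.eq_some h1
    obtain ⟨E', hE', m', S', rfl, h'⟩ := hU.eq_branch
    refine .case x D P Δ E' hE' m' S' e (fun a ha => h2 a (h' a ha).1) fun i => ?_
    obtain ⟨T, hT, h4⟩ := h3 i
    by_cases hi : i.1 ∈ E'
    · obtain ⟨ha, -, hS⟩ := h' i.1 hi
      refine ⟨S' ⟨i.1, hi⟩, fun _ => rfl, _, hs.set ?_, h4⟩
      rw [hT ha]
      exact hS
    · exact ⟨T, fun h => (hi h).elim, _, hs.set (.refl T), h4⟩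
  | fork x P Q Γ Γ₁ Γ₂ U S V h1 h2 h3 h4 _ ih =>
    obtain ⟨U', e, hU⟩ := hs.eq_some h1
    obtain ⟨S', V', h2', hS, hV⟩ := hU.step_out_chan h2
    obtain ⟨Δ₁, Δ₂, h', e1, e2⟩ := (hs.remove (x := x)).split h3
    exact .fork x P Q Δ Δ₁ Δ₂ U' S' V' e h2' h' ⟨_, e1.bind hS, h4⟩ (ih _ (e2.set hV))
  | join x P Γ S T h1 h2 =>
    obtain ⟨U', e, hU⟩ := hs.eq_some h1
    obtain ⟨S', T', rfl, hS, hT⟩ := hU.eq_mult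
    exact .join x P Δ S' T' e ⟨_, (hs.set hT).bind hS, h2⟩

/-- Strengthening: an injective renaming can be undone. -/
theorem Ty.of_rename {ρ : ℕ → ℕ} (hρ : Function.Injective ρ) (h : Ty 𝒟 (P.rename ρ) Γ) :
    Ty 𝒟 P (Γ ∘ ρ) := by
  have hg := Function.leftInverse_invFun hρ
  have key := h.rename (ρ := Function.invFun ρ) (Δ := Γ ∘ ρ) ?_
  · rwa [Proc.rename_rename, Proc.rename_eq_self (ρ := Function.invFun ρ ∘ ρ) fun x _ => hg x]
      at key
  · have hr : ∀ y, Γ y ≠ none → ∃ x, ρ x = y := fun y hy => by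
      obtain ⟨x, -, e⟩ := Proc.mem_fn_rename.1 (h.mem_fn.2 hy)
      exact ⟨x, e⟩
    constructor
    · intro y hy
      obtain ⟨x, rfl⟩ := hr y hy
      simp [hg x]
    · intro x hx
      exact ⟨ρ x, hx, hg x⟩
    · intro y y' hy hy'
      obtain ⟨x, rfl⟩ := hr y hy
      obtain ⟨x', rfl⟩ := hr y' hy'
      rw [hg x, hg x']
      exact congrArg ρ

theorem Ty.eq_none_of_rename {ρ : ℕ → ℕ} (h : Ty 𝒟 (P.rename ρ) Γ) (hx : ∀ z, ρ z ≠ x) :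
    Γ x = none := by
  by_contra hn
  obtain ⟨z, -, hz⟩ := Proc.mem_fn_rename.1 (h.mem_fn.2 hn)
  exact hx z hz

/-! ### From the original typing rules to asynchronous typing -/

/-- The inductive layer of asynchronous typing for the processes of measure at most `n`, by
induction on the process. Outputs have continuations of measure less than `n`, and invocations are
either excluded or dealt with by the hypothesis `hP`. -/
theorem TypingRule.rule_of_guarded {J : ℕ → Proc Tag Name → Ctx Tag → Prop}
    (hJ : ∀ m Q Δ, J m Q Δ → TypingRule 𝒟 J m Q Δ) {n : ℕ}
    (ih : ∀ m < n, ∀ P Γ, J m P Γ → Rule 𝒟 (fun P Γ => ∃ n, J n P Γ) P Γ)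
    (hP : P.Guarded ∨ ∀ A args Γ, ∀ m ≤ n, J m (.call A args) Γ →
      Rule 𝒟 (fun P Γ => ∃ n, J n P Γ) (.call A args) Γ)
    {m : ℕ} (hm : m ≤ n) (h : J m P Γ) : Rule 𝒟 (fun P Γ => ∃ n, J n P Γ) P Γ := by
  induction P generalizing m Γ with
  | link =>
    cases hJ _ _ _ h with
    | link _ _ _ S T _ h1 h2 => exact .link _ _ S T h1 h2
  | close => cases hJ _ _ _ h; exact .close _
  | select x a P =>
    cases hJ _ _ _ h with
    | select n' _ _ _ D hD m S k h1 h2 =>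
      exact .select _ _ (m k) _ _ _ _ h1 (Must.branch D hD m S k).step
        (ih n' (by omega) _ _ h2)
  | fork x P Q =>
    cases hJ _ _ _ h with
    | fork n₁ n₂ _ _ _ _ Γ₁ Γ₂ S T h1 h2 h3 h4 =>
      exact .fork _ _ _ _ Γ₁ Γ₂ _ S T h1 (Must.mult S T).step h2 ⟨_, h3⟩
        (ih n₂ (by omega) _ _ h4)
  | choice P Q =>
    cases hJ _ _ _ h with
    | choiceLeft n₁ n₂ _ _ _ h1 h2 => exact .choice _ _ _ ⟨_, h1⟩ ⟨_, h2⟩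
    | choiceRight n₁ n₂ _ _ _ h1 h2 => exact .choice _ _ _ ⟨_, h1⟩ ⟨_, h2⟩
  | done => cases hJ _ _ _ h; exact .done
  | call A args =>
    rcases hP with hP | hP
    · exact hP.elim
    · exact hP A args Γ m hm h
  | wait x P =>
    cases hJ _ _ _ h with
    | wait _ _ _ _ h1 h2 => exact .wait _ _ _ h1 ⟨_, h2⟩
  | case x D P =>
    cases hJ _ _ _ h with
    | case _ _ _ _ _ m S E hE hED h1 h2 =>
      exact .case _ _ _ _ E hE _ _ h1 hED fun i => ⟨S i, fun _ => rfl, _, h2 i⟩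
  | join x P =>
    cases hJ _ _ _ h with
    | join _ _ _ _ S T h1 h2 => exact .join _ _ _ S T h1 ⟨_, h2⟩
  | cut P Q ihP ihQ =>
    cases hJ _ _ _ h with
    | cut n₁ n₂ _ _ _ Γ₁ Γ₂ S T h1 h2 h3 h4 =>
      exact .cut _ _ _ Γ₁ Γ₂ S T h1 h2 (ihP (hP.imp_left And.left) (by omega) h3)
        (ihQ (hP.imp_left And.right) (by omega) h4)

/-- Well typed processes are asynchronously typed. The inductive layer of the derivation exists
because the measure decreases at each output, and because the unfolding of an invocation, which
does not increase the measure, has no other invocation outside of prefixes and choices. -/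
theorem WellTyped.ty (h : WellTyped 𝒟 P Γ) : Ty 𝒟 P Γ := by
  obtain ⟨n, J, hJ, h⟩ := h
  refine ⟨fun P Γ => ∃ n, J n P Γ, ?_, n, h⟩
  rintro P Γ ⟨n, h⟩
  induction n using Nat.strong_induction_on generalizing P Γ with
  | _ n ih =>
    refine TypingRule.rule_of_guarded hJ (fun m hm _ _ h => ih m hm _ _ h) (Or.inr ?_) le_rfl h
    intro A args Γ m hm h
    cases hJ _ _ _ h with
    | call _ k _ _ _ h1 h2 h3 h4 h5 =>
      exact .call _ _ _ h2 h3 h4 (TypingRule.rule_of_guarded hJ (fun m hm _ _ h => ih m hm _ _ h)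
        (Or.inl (𝒟.guarded_unfold A args)) (h1.trans hm) h5)

end Typing

/-! ### Typing of buffers -/

section Congruence

variable {Tag Name : Type}

namespace Ctx

variable {Γ Γ' Γ₁ Γ₂ Γ₃ Γ₂₃ : Ctx Tag} {S T : SType Tag} {x y : ℕ} {ρ : ℕ → ℕ}

/-- The context `Γ` in the scope of a binder of a channel that is not used. -/
def shift (Γ : Ctx Tag) : Ctx Tag
  | 0 => none
  | n + 1 => Γ n

@[simp] theorem shift_zero : Γ.shift 0 = none := rfl

@[simp] theorem shift_succ : Γ.shift (x + 1) = Γ x := rfl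

theorem eq_bind (h : Γ 0 = some S) : Γ = Ctx.bind (Γ ∘ Nat.succ) S := by
  funext n; cases n
  · exact h
  · rfl

theorem eq_shift (h : Γ 0 = none) : Γ = Ctx.shift (Γ ∘ Nat.succ) := by
  funext n; cases n
  · exact h
  · rfl

theorem Split.bind_left (h : Split Γ Γ₁ Γ₂) : Split (Γ.bind S) (Γ₁.bind S) Γ₂.shift := by
  rintro (_ | x)
  · exact Or.inl ⟨rfl, rfl⟩
  · exact h x

theorem Split.shift (h : Split Γ Γ₁ Γ₂) : Split Γ.shift Γ₁.shift Γ₂.shift := by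
  rintro (_ | x)
  · exact Or.inl ⟨rfl, rfl⟩
  · exact h x

theorem Split.comp (h : Split Γ Γ₁ Γ₂) (ρ : ℕ → ℕ) : Split (Γ ∘ ρ) (Γ₁ ∘ ρ) (Γ₂ ∘ ρ) :=
  fun x => h (ρ x)

theorem Split.remove_right (h : Split Γ Γ₁ Γ₂) (hx : Γ₂ x = some S) :
    Split (Γ.remove x) Γ₁ (Γ₂.remove x) :=
  (h.symm.remove_left hx).symm

theorem Split.set_right (h : Split Γ Γ₁ Γ₂) (hx : Γ₂ x = some S) :
    Split (Γ.set x T) Γ₁ (Γ₂.set x T) :=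
  (h.symm.set_left hx).symm

theorem Split.eq_right (h : Split Γ Γ₁ Γ₂) (hx : Γ₂ x = some S) : Γ x = some S :=
  h.symm.eq_left hx

theorem Split.assoc_symm (h : Split Γ Γ₁ Γ₂₃) (h' : Split Γ₂₃ Γ₂ Γ₃) :
    ∃ Γ₁₂, Split Γ Γ₁₂ Γ₃ ∧ Split Γ₁₂ Γ₁ Γ₂ := by
  obtain ⟨Γ₁₂, h1, h2⟩ := h.symm.assoc h'.symm
  exact ⟨Γ₁₂, h1.symm, h2.symm⟩

theorem Renames.lift_shift (h : Renames ρ Γ Γ') : Renames (lift ρ) Γ.shift Γ'.shift where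
  map := by
    rintro (_ | x) hx
    · rfl
    · exact h.map x hx
  back := by
    rintro (_ | y) hy
    · exact (hy rfl).elim
    · obtain ⟨x, hx, rfl⟩ := h.back y hy
      exact ⟨x + 1, hx, rfl⟩
  inj := by
    rintro (_ | x) (_ | x') hx hx' e
    · rfl
    · exact (hx rfl).elim
    · exact (hx' rfl).elim
    · simp only [lift_succ, Nat.add_right_cancel_iff] at e
      rw [h.inj x x' hx hx' e]

theorem renames_succ (Γ : Ctx Tag) : Renames Nat.succ Γ Γ.shift where
  map := fun _ _ => rfl
  back := by
    rintro (_ | y) hy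
    · exact (hy rfl).elim
    · exact ⟨y, hy, rfl⟩
  inj := fun _ _ _ _ => Nat.succ.inj

theorem renames_inst_shift (Γ : Ctx Tag) (y : ℕ) : Renames (inst y) Γ.shift Γ where
  map := by
    rintro (_ | x) hx
    · exact (hx rfl).elim
    · rfl
  back := fun z hz => ⟨z + 1, hz, rfl⟩
  inj := by
    rintro (_ | x) (_ | x') hx hx' e
    · rfl
    · exact (hx rfl).elim
    · exact (hx' rfl).elim
    · exact congrArg _ e

theorem renames_inst_bind (hy : Γ y = none) : Renames (inst y) (Γ.bind S) (Γ.set y S) where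
  map := by
    rintro (_ | x) hx
    · simp [set_apply]
    · rw [bind_succ] at hx
      rw [inst_succ, set_apply, bind_succ, if_neg]
      rintro rfl
      exact hx hy
  back := by
    intro z hz
    by_cases e : z = y
    · exact ⟨0, by simp, e.symm⟩
    · rw [set_apply, if_neg e] at hz
      exact ⟨z + 1, hz, rfl⟩
  inj := by
    rintro (_ | x) (_ | x') hx hx' e
    · rfl
    · have e : y = x' := e
      exact (hx' (e ▸ hy)).elim
    · have e : x = y := e
      exact (hx (e ▸ hy)).elim
    · exact congrArg _ e

theorem renames_exch (Γ : Ctx Tag) (S T : SType Tag) :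
    Renames exch ((Γ.bind S).bind T) ((Γ.bind T).bind S) where
  map := by rintro (_ | _ | x) _ <;> rfl
  back := fun y hy => ⟨exch y, by rcases y with _ | _ | y <;> simp_all, exch_exch y⟩
  inj := fun _ _ _ _ e => exch_injective e

end Ctx

/-- `BufTy 𝒟 B Γ U V` holds when the messages in the buffer `B` turn the type `U` of its channel
into `V`. The context `Γ` is that of the processes in `B`. -/
inductive BufTy (𝒟 : Program Tag Name) : Buf Tag Name → Ctx Tag → SType Tag → SType Tag → Prop
  | hole (U) : BufTy 𝒟 .hole Ctx.empty U U
  | tag (a m B Γ U V W) : Step .out (.tag a m) U V → BufTy 𝒟 B Γ V W →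
      BufTy 𝒟 (.tag a B) Γ U W
  | chan (P B Γ Γ₁ Γ₂ U S V W) : Step .out (.chan S) U V → Ctx.Split Γ Γ₁ Γ₂ →
      Ty 𝒟 P (Γ₁.bind S) → BufTy 𝒟 B Γ₂ V W → BufTy 𝒟 (.chan P B) Γ U W

variable {𝒟 : Program Tag Name} {P Q R : Proc Tag Name} {B B' : Buf Tag Name}
  {Γ Γ' Δ Γ₁ Γ₂ ΓB ΓR : Ctx Tag} {S T U V : SType Tag} {x y : ℕ}

theorem Ty.fill_inv (h : Ty 𝒟 (B.fill x P) Γ) (hx : Γ x = some U) : ∃ ΓB ΓR V,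
    Ctx.Split (Γ.remove x) ΓB ΓR ∧ BufTy 𝒟 B ΓB U V ∧ Ty 𝒟 P (ΓR.set x V) := by
  induction B generalizing Γ U with
  | hole =>
    refine ⟨Ctx.empty, Γ.remove x, U, Ctx.split_empty, .hole U, ?_⟩
    have : (Γ.remove x).set x U = Γ := by funext z; grind
    rwa [this]
  | tag a B ih =>
    obtain ⟨m, U', V, h1, h2, h3⟩ := h.select_inv
    rw [hx] at h1; cases h1
    obtain ⟨ΓB, ΓR, W, h4, h5, h6⟩ := ih h3 (U := V) (by grind)
    have : (Γ.set x V).remove x = Γ.remove x := by funext z; grind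
    rw [this] at h4
    exact ⟨ΓB, ΓR, W, h4, .tag a m B ΓB U V W h2 h5, h6⟩
  | chan P B ih =>
    obtain ⟨Γ₁, Γ₂, U', S, V, h1, h2, h3, h4, h5⟩ := h.fork_inv
    rw [hx] at h1; cases h1
    obtain ⟨ΓB, ΓR, W, h6, h7, h8⟩ := ih h5 (U := V) (by grind)
    have h2x : Γ₂ x = none := (h3.eq_none (by grind)).2
    have : (Γ₂.set x V).remove x = Γ₂ := by funext z; grind
    rw [this] at h6
    obtain ⟨Γ₁₂, h9, h10⟩ := h3.assoc_symm h6
    exact ⟨Γ₁₂, ΓR, W, h9, .chan P B _ _ _ U S V W h2 h10 h4 h7, h8⟩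

theorem BufTy.fill (hB : BufTy 𝒟 B ΓB U V) (hx : Γ x = some U)
    (hs : Ctx.Split (Γ.remove x) ΓB ΓR) (h : Ty 𝒟 P (ΓR.set x V)) : Ty 𝒟 (B.fill x P) Γ := by
  induction hB generalizing Γ with
  | hole U =>
    have : ΓR.set x U = Γ := by
      funext z
      have := hs z
      grind [Ctx.empty_apply]
    rwa [this] at h
  | tag a m B Γ₀ U V W h1 _ ih =>
    refine (Rule.select x a m _ Γ U V hx h1 (ih ?_ ?_ h).rule).ty
    · grind
    · have : (Γ.set x V).remove x = Γ.remove x := by funext z; grind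
      rwa [this]
  | chan P B Γ₀ Γ₁ Γ₂ U S V W h1 h2 h3 _ ih =>
    obtain ⟨Γ₂₃, h4, h5⟩ := hs.assoc h2
    refine (Rule.fork x P _ Γ Γ₁ Γ₂₃ U S V hx h1 h4 h3 (ih ?_ ?_ h).rule).ty
    · grind
    · have h2x : Γ₂₃ x = none := (h4.eq_none (by grind)).2
      have : (Γ₂₃.set x V).remove x = Γ₂₃ := by funext z; grind
      rwa [this]

theorem Ty.fill_bind_inv (h : Ty 𝒟 (B.fill 0 P) (Γ.bind S)) : ∃ ΓB ΓR V,
    Ctx.Split Γ ΓB ΓR ∧ BufTy 𝒟 B ΓB.shift S V ∧ Ty 𝒟 P (ΓR.bind V) := by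
  obtain ⟨ΓB, ΓR, V, h1, h2, h3⟩ := h.fill_inv (U := S) rfl
  have h0 : ΓB 0 = none ∧ ΓR 0 = none := h1.eq_none (by grind)
  rw [Ctx.eq_shift h0.1] at h2
  refine ⟨_, ΓR ∘ Nat.succ, V, fun z => ?_, h2, ?_⟩
  · simpa [Ctx.remove_apply] using h1 (z + 1)
  · have : ΓR.set 0 V = Ctx.bind (ΓR ∘ Nat.succ) V := by
      funext z
      cases z
      · simp [Ctx.set_apply]
      · simp [Ctx.set_apply]
    rwa [this] at h3

theorem BufTy.fill_bind (hB : BufTy 𝒟 B ΓB.shift S V) (hs : Ctx.Split Γ ΓB ΓR)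
    (h : Ty 𝒟 P (ΓR.bind V)) : Ty 𝒟 (B.fill 0 P) (Γ.bind S) := by
  refine hB.fill (ΓR := ΓR.shift) rfl ?_ ?_
  · have : (Γ.bind S).remove 0 = Γ.shift := by
      funext z
      cases z <;> simp [Ctx.remove_apply]
    rw [this]
    exact hs.shift
  · have : ΓR.shift.set 0 V = ΓR.bind V := by
      funext z
      cases z <;> simp [Ctx.set_apply]
    rwa [this]

/-- The channel of a nonempty buffer is in the context. -/
theorem Ty.fill_eq_some (h : Ty 𝒟 (B.fill x P) Γ) : B = .hole ∨ ∃ U, Γ x = some U := by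
  cases B with
  | hole => exact Or.inl rfl
  | tag a B =>
    obtain ⟨m, U, V, h1, -⟩ := h.select_inv
    exact Or.inr ⟨U, h1⟩
  | chan P B =>
    obtain ⟨Γ₁, Γ₂, U, S, V, h1, -⟩ := h.fork_inv
    exact Or.inr ⟨U, h1⟩

theorem BufTy.rename {ρ : ℕ → ℕ} (h : BufTy 𝒟 B Γ U V) (hρ : Ctx.Renames ρ Γ Γ') :
    BufTy 𝒟 (B.rename ρ) Γ' U V := by
  induction h generalizing Γ' with
  | hole U => rw [hρ.eq_empty]; exact .hole U
  | tag a m B Γ U V W h _ ih => exact .tag a m _ _ U V W h (ih hρ)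
  | chan P B Γ Γ₁ Γ₂ U S V W h h1 h2 _ ih =>
    obtain ⟨Γ₁', Γ₂', h', e1, e2⟩ := hρ.split h1
    exact .chan _ _ _ _ _ U S V W h h' (h2.rename (e1.bind S)) (ih e2)

theorem BufTy.of_rename {ρ : ℕ → ℕ} (hρ : Function.Injective ρ) (h : BufTy 𝒟 (B.rename ρ) Γ U V) :
    BufTy 𝒟 B (Γ ∘ ρ) U V := by
  induction B generalizing Γ U with
  | hole => cases h; exact .hole _
  | tag a B ih =>
    cases h with
    | tag _ m _ _ _ V W h h' => exact .tag a m _ _ U V _ h (ih h')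
  | chan P B ih =>
    cases h with
    | chan _ _ _ Γ₁ Γ₂ _ S V W h h1 h2 h3 =>
      have h2 := h2.of_rename (lift_injective hρ)
      have : Γ₁.bind S ∘ lift ρ = Ctx.bind (Γ₁ ∘ ρ) S := by funext z; cases z <;> rfl
      rw [this] at h2
      exact .chan P B _ _ _ U S V _ h (h1.comp ρ) h2 (ih h3)

theorem BufTy.eq_none_of_rename {ρ : ℕ → ℕ} (h : BufTy 𝒟 (B.rename ρ) Γ U V)
    (hx : ∀ z, ρ z ≠ x) : Γ x = none := by
  induction B generalizing Γ U with
  | hole => cases h; rfl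
  | tag a B ih =>
    cases h with
    | tag _ m _ _ _ V W h h' => exact ih h'
  | chan P B ih =>
    cases h with
    | chan _ _ _ Γ₁ Γ₂ _ S V W h h1 h2 h3 =>
      have h2 : (Γ₁.bind S) (x + 1) = none := h2.eq_none_of_rename <| by
        rintro (_ | z)
        · simp
        · simpa using hx z
      have h3 := ih h3
      have := h1 x
      simp only [Ctx.bind_succ] at h2
      grind

/-- A message that can be input before the output of a buffer can be input afterwards. -/
theorem BufTy.step_inp {σ : Msg Tag} {U' : SType Tag} (h : BufTy 𝒟 B Γ U V)
    (hs : Step .inp σ U U') : ∃ V', BufTy 𝒟 B Γ U' V' ∧ Step .inp σ V V' := by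
  induction h generalizing U' with
  | hole U => exact ⟨U', .hole U', hs⟩
  | tag a m B Γ U V W h _ ih =>
    obtain ⟨V', h1, h2⟩ := Step.diamond hs h
    obtain ⟨W', h3, h4⟩ := ih h2
    exact ⟨W', .tag a m B Γ U' V' W' h1 h3, h4⟩
  | chan P B Γ Γ₁ Γ₂ U S V W h h1 h2 _ ih =>
    obtain ⟨V', h3, h4⟩ := Step.diamond hs h
    obtain ⟨W', h5, h6⟩ := ih h4
    exact ⟨W', .chan P B Γ Γ₁ Γ₂ U' S V' W' h3 h1 h2 h5, h6⟩

/-- A buffer can be forwarded through a link, which may have emitted a buffer `B'` on its own. The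
forked processes in `B` are retyped by subsumption. -/
theorem BufTy.forward {S₀ T₁ : SType Tag} (h : BufTy 𝒟 B Γ S S₀) (hc : Correct S T)
    (h' : BufTy 𝒟 B' Γ' T T₁) (hl : FairSub T₁.dual U) :
    ∃ T' T₁' U', Correct S₀ T' ∧ BufTy 𝒟 B' Γ' T' T₁' ∧ FairSub T₁'.dual U' ∧
      BufTy 𝒟 B Γ U U' := by
  induction h generalizing T T₁ U with
  | hole S => exact ⟨T, T₁, U, hc, h', hl, .hole U⟩
  | tag a m B Γ S S' S₀ hs _ ih =>
    obtain ⟨T', ht, hc'⟩ := hc.out_inp (σ := .tag a m) trivial hs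
    obtain ⟨T₁', h1, h2⟩ := h'.step_inp ht
    obtain ⟨U', hu, hl'⟩ := hl.step_out (σ := .tag a m) trivial h2.dual
    obtain ⟨T'', T₁'', U'', h3, h4, h5, h6⟩ := ih hc' h1 hl'
    exact ⟨T'', T₁'', U'', h3, h4, h5, .tag a m B Γ U U' U'' hu h6⟩
  | chan P B Γ Γ₁ Γ₂ S S₁ S' S₀ hs hΓ hP _ ih =>
    obtain ⟨R₁, T', ht, hc₁, hc'⟩ := hc.out_inp_chan hs
    obtain ⟨T₁', h1, h2⟩ := h'.step_inp ht
    obtain ⟨W, U', hu, hW, hl'⟩ := hl.step_out_chan h2.dual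
    obtain ⟨T'', T₁'', U'', h3, h4, h5, h6⟩ := ih hc' h1 hl'
    refine ⟨T'', T₁'', U'', h3, h4, h5, .chan P B Γ Γ₁ Γ₂ U W U' U'' hu hΓ (hP.sub ?_) h6⟩
    have h7 : FairSub S₁ R₁.dual := fairSub_iff.2 (by simpa using hc₁.symm)
    exact (Ctx.Sub.refl Γ₁).bind (h7.trans hW)

/-! ### Structural precongruence preserves typing -/

theorem Ty.precong_wait (h : Ty 𝒟 (.cut (B.fill 0 (.wait (y + 1) P)) Q) Γ) :
    Ty 𝒟 (.wait y (.cut (B.fill 0 P) Q)) Γ := by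
  obtain ⟨Γ₁, Γ₂, S, T, hs, hc, h1, h2⟩ := h.cut_inv
  obtain ⟨ΓB, ΓR, V, hs', hB, h1⟩ := h1.fill_bind_inv
  obtain ⟨hy, h1⟩ := h1.wait_inv
  rw [← Ctx.bind_remove] at h1
  rw [Ctx.bind_succ] at hy
  have hy1 := hs'.eq_right hy
  exact (Rule.wait _ _ _ (hs.eq_left hy1) (Rule.cut _ _ _ _ _ S T (hs.remove_left hy1) hc
    (hB.fill_bind (hs'.remove_right hy) h1).rule h2.rule).ty).ty

theorem Ty.precong_case {D : Finset Tag} {P : {a // a ∈ D} → Proc Tag Name}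
    (h : Ty 𝒟 (.cut (B.fill 0 (.case (y + 1) D P)) Q) Γ) :
    Ty 𝒟 (.case y D (fun i => .cut (B.fill 0 (P i)) Q)) Γ := by
  obtain ⟨Γ₁, Γ₂, S, T, hs, hc, h1, h2⟩ := h.cut_inv
  obtain ⟨ΓB, ΓR, V, hs', hB, h1⟩ := h1.fill_bind_inv
  obtain ⟨E, hE, m, S', hy, hED, h1⟩ := h1.case_inv
  rw [Ctx.bind_succ] at hy
  have hy1 := hs'.eq_right hy
  refine (Rule.case _ _ _ _ E hE m S' (hs.eq_left hy1) hED fun i => ?_).ty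
  obtain ⟨W, hW, h1⟩ := h1 i
  rw [← Ctx.bind_set] at h1
  exact ⟨W, hW, (Rule.cut _ _ _ _ _ S T (hs.set_left hy1) hc
    (hB.fill_bind (hs'.set_right hy) h1).rule h2.rule).ty⟩

theorem Ty.precong_join (h : Ty 𝒟 (.cut (B.fill 0 (.join (y + 1) P)) Q) Γ) :
    Ty 𝒟 (.join y (.cut ((B.rename (lift Nat.succ)).fill 0 (P.rename exch))
      (Q.rename (lift Nat.succ)))) Γ := by
  obtain ⟨Γ₁, Γ₂, S, T, hs, hc, h1, h2⟩ := h.cut_inv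
  obtain ⟨ΓB, ΓR, V, hs', hB, h1⟩ := h1.fill_bind_inv
  obtain ⟨S', T', hy, h1⟩ := h1.join_inv
  rw [Ctx.bind_succ] at hy
  have hy1 := hs'.eq_right hy
  rw [← Ctx.bind_set] at h1
  refine (Rule.join _ _ _ S' T' (hs.eq_left hy1)
    (Rule.cut _ _ _ _ _ S T (hs.set_left hy1).bind_left hc ?_ ?_).ty).ty
  · refine Ty.rule (BufTy.fill_bind (hB.rename (Ctx.renames_succ _).lift_shift)
      (hs'.set_right hy).symm.bind_left.symm (h1.rename (Ctx.renames_exch _ _ _)))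
  · exact (h2.rename ((Ctx.renames_succ Γ₂).bind T)).rule

theorem Ty.link_zero_inv (h : Ty 𝒟 (.link 0 (y + 1)) (Γ.bind S)) :
    ∃ U, FairSub S.dual U ∧ Γ = Ctx.empty.set y U := by
  obtain ⟨-, S', U, h1, e⟩ := h.link_inv
  have e0 := congrFun e 0
  simp only [Ctx.bind_zero, Ctx.set_apply] at e0
  cases e0
  refine ⟨U, h1, ?_⟩
  funext z
  have := congrFun e (z + 1)
  simpa [Ctx.set_apply] using this

theorem Ty.link_zero (h : FairSub S.dual U) :
    Ty 𝒟 (.link 0 (y + 1)) ((Ctx.empty.set y U).bind S) := by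
  have e : (Ctx.empty.set y U).bind S = (Ctx.empty.set 0 S).set (y + 1) U := by
    funext z
    cases z <;> simp [Ctx.set_apply]
  rw [e]
  exact (Rule.link _ _ _ _ (by simp) h).ty

theorem Ty.precong_pull0 (h : Ty 𝒟 (.cut (B.fill 0 P) (B'.fill 0 (.link 0 (y + 1)))) Γ) :
    Ty 𝒟 ((B.rename (inst y)).fill y (.cut P (B'.fill 0 (.link 0 (y + 1))))) Γ := by
  obtain ⟨Γ₁, Γ₂, S, T, hs, hc, h1, h2⟩ := h.cut_inv
  obtain ⟨ΓB, ΓP, S₀, hs₁, hB, hP⟩ := h1.fill_bind_inv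
  obtain ⟨ΓB', ΓL, T₁, hs₂, hB', hL⟩ := h2.fill_bind_inv
  obtain ⟨U, hl, rfl⟩ := hL.link_zero_inv
  obtain ⟨T', T₁', U', hc', hB'', hl', hBU⟩ := hB.forward hc hB' hl
  obtain ⟨Γ₂₃, hs₃, hs₄⟩ := hs.assoc hs₁
  have hyL : (Ctx.empty.set y U) y = some U := by grind
  have hy2 := hs₂.eq_right hyL
  have hy23 := hs₄.eq_right hy2
  refine (hBU.rename (Ctx.renames_inst_shift ΓB y)).fill (hs₃.eq_right hy23)
    (hs₃.remove_right hy23) ?_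
  have e : (Γ₂₃.remove y).set y U' = Γ₂₃.set y U' := by funext z; grind
  have e' : (Ctx.empty.set y U).set y U' = Ctx.empty.set y U' := by funext z; grind
  rw [e]
  refine (Rule.cut _ _ _ _ _ _ _ (hs₄.set_right hy2) hc' hP.rule
    (hB''.fill_bind (hs₂.set_right hyL) ?_).rule).ty
  rw [e']
  exact .link_zero hl'

theorem Ty.precong_pull1 (h : Ty 𝒟 (.cut (.fork (y + 1) P (Q.rename Nat.succ)) R) Γ) :
    Ty 𝒟 (.fork y (.cut (P.rename exch) (R.rename (lift Nat.succ))) Q) Γ := by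
  obtain ⟨Γ₁, Γ₂, S, T, hs, hc, h1, h2⟩ := h.cut_inv
  obtain ⟨ΓP, ΓQ, U, S', V, hy, hU, hs', hP, hQ⟩ := h1.fork_inv
  rw [Ctx.bind_succ] at hy
  have h0 := hQ.eq_none_of_rename (x := 0) (by simp)
  have hP0 : ΓP 0 = some S := by
    have := hs' 0
    have : (Γ₁.bind S) 0 = some S := rfl
    grind
  replace hQ := hQ.of_rename Nat.succ_injective
  have hs₁ : Ctx.Split (Γ₁.remove y) (ΓP ∘ Nat.succ) (ΓQ ∘ Nat.succ) := by
    intro z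
    simpa [Ctx.remove_apply] using hs' (z + 1)
  have e : ΓQ.set (y + 1) V ∘ Nat.succ = Ctx.set (ΓQ ∘ Nat.succ) y V := by
    funext z
    simp [Ctx.set_apply]
  rw [e] at hQ
  rw [Ctx.eq_bind hP0] at hP
  obtain ⟨Γ₃, hs₃, hs₄⟩ := (hs.remove_left hy).symm.assoc_symm hs₁
  refine (Rule.fork _ _ _ _ Γ₃ _ U S' V (hs.eq_left hy) hU hs₃ ?_ hQ.rule).ty
  exact (Rule.cut _ _ _ _ _ S T hs₄.symm.bind_left hc (hP.rename (Ctx.renames_exch _ _ _)).rule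
    (h2.rename ((Ctx.renames_succ Γ₂).bind T)).rule).ty

theorem Ty.precong_pull2 (h : Ty 𝒟 (.cut ((B.rename Nat.succ).fill (y + 1) P) Q) Γ) :
    Ty 𝒟 (B.fill y (.cut P Q)) Γ := by
  obtain ⟨Γ₁, Γ₂, S, T, hs, hc, h1, h2⟩ := h.cut_inv
  rcases h1.fill_eq_some with hB | ⟨U, hy⟩
  · cases B <;> first | exact h | cases hB
  · obtain ⟨ΓB, ΓR, V, hs', hB, hP⟩ := h1.fill_inv hy
    have h0 := hB.eq_none_of_rename (x := 0) (by simp)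
    have hR0 : ΓR 0 = some S := by
      have := hs' 0
      have : (Γ₁.bind S) 0 = some S := rfl
      grind
    replace hB := hB.of_rename Nat.succ_injective
    have hs₁ : Ctx.Split (Γ₁.remove y) (ΓB ∘ Nat.succ) (ΓR ∘ Nat.succ) := by
      intro z
      simpa [Ctx.remove_apply] using hs' (z + 1)
    rw [Ctx.eq_bind hR0, ← Ctx.bind_set] at hP
    rw [Ctx.bind_succ] at hy
    obtain ⟨Γ₃, hs₃, hs₄⟩ := (hs.remove_left hy).assoc hs₁
    refine hB.fill (hs.eq_left hy) hs₃ (Rule.cut _ _ _ _ _ S T ?_ hc hP.rule h2.rule).ty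
    intro z
    have := hs₄ z
    have := hs.right_eq_none hy
    grind

theorem Ty.precong_pull3 (hxy : x ≠ y) (hx : x + 1 ∈ P.fn)
    (h : Ty 𝒟 (B.fill x (.fork y P Q)) Γ) :
    Ty 𝒟 (.fork y ((B.rename Nat.succ).fill (x + 1) P) Q) Γ := by
  rcases h.fill_eq_some with rfl | ⟨U, hU⟩
  · exact h
  · obtain ⟨ΓB, ΓR, V, hs, hB, h⟩ := h.fill_inv hU
    obtain ⟨ΓP, ΓQ, U', S, W, hy, hW, hs', hP, hQ⟩ := h.fork_inv
    rw [hP.mem_fn, Ctx.bind_succ] at hx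
    have hPx : ΓP x = some V := by
      have := hs' x
      grind
    -- The payload inherits the buffer: its context gains that of the buffer, and `x` has again
    -- the type it had before the buffer.
    refine (Rule.fork y _ Q Γ
      (fun z => if z = x then some U else if ΓB z = none then ΓP z else ΓB z) ΓQ U' S W
      ?_ hW ?_ (BufTy.fill (ΓR := (ΓP.remove x).bind S) (U := U) (V := V)
        (hB.rename (Ctx.renames_succ ΓB)) ?_ ?_ ?_) hQ.rule).ty
    · have := hs y
      grind
    · intro z
      have := hs z
      have := hs' z
      grind
    · simp
    · rintro (_ | z)
      · exact Or.inr ⟨by simp [Ctx.remove_apply], rfl⟩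
      · have := hs z
        have := hs' z
        simp only [Ctx.remove_apply, Ctx.bind_succ, Ctx.shift_succ]
        grind
    · rw [← Ctx.bind_set]
      have e : (ΓP.remove x).set x V = ΓP := by funext z; grind
      rwa [e]

theorem Ty.precong_pull4 (hxy : x ≠ y) (hx : x ∈ P.fn)
    (h : Ty 𝒟 (B.fill x (B'.fill y P)) Γ) : Ty 𝒟 (B'.fill y (B.fill x P)) Γ := by
  rcases h.fill_eq_some with rfl | ⟨U, hU⟩
  · exact h
  · have h₀ := h
    obtain ⟨ΓB, ΓR, V, hs, hB, h⟩ := h.fill_inv hU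
    rcases h.fill_eq_some with rfl | ⟨U', hU'⟩
    · exact h₀
    · obtain ⟨ΓB', ΓP, V', hs', hB', hP⟩ := h.fill_inv hU'
      rw [hP.mem_fn] at hx
      have hPx : ΓP x = some V := by
        have := hs' x
        grind
      -- In the context between the two buffers, `x` has the type it had before `B`.
      refine hB'.fill (ΓR := fun z => if z = x then some U else if ΓB z = none then ΓP z else ΓB z)
        ?_ ?_ (hB.fill (ΓR := (ΓP.set y V').remove x) ?_ ?_ ?_)
      · have := hs y
        grind
      · intro z
        have := hs z
        have := hs' z
        grind
      · grind
      · intro z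
        have := hs z
        have := hs' z
        grind
      · have e : ((ΓP.set y V').remove x).set x V = ΓP.set y V' := by funext z; grind
        rwa [e]

theorem PreCong.ty (hPQ : PreCong 𝒟 P Q) (h : Ty 𝒟 P Γ) : Ty 𝒟 Q Γ := by
  induction hPQ generalizing Γ with
  | refl P => exact h
  | trans _ _ ih ih' => exact ih' (ih h)
  | congSelect x a _ ih =>
    obtain ⟨m, U, V, h1, h2, h3⟩ := h.select_inv
    exact (Rule.select x a m _ Γ U V h1 h2 (ih h3).rule).ty
  | congFork x _ _ ih ih' =>
    obtain ⟨Γ₁, Γ₂, U, S, V, h1, h2, h3, h4, h5⟩ := h.fork_inv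
    exact (Rule.fork x _ _ Γ Γ₁ Γ₂ U S V h1 h2 h3 (ih h4) (ih' h5).rule).ty
  | congChoice _ _ ih ih' =>
    exact (Rule.choice _ _ _ (ih h.choice_inv.1) (ih' h.choice_inv.2)).ty
  | congWait x _ ih => exact (Rule.wait x _ Γ h.wait_inv.1 (ih h.wait_inv.2)).ty
  | congCase x D _ ih =>
    obtain ⟨E, hE, m, S, h1, h2, h3⟩ := h.case_inv
    refine (Rule.case x D _ Γ E hE m S h1 h2 fun i => ?_).ty
    obtain ⟨T, hT, h4⟩ := h3 i
    exact ⟨T, hT, ih i h4⟩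
  | congJoin x _ ih =>
    obtain ⟨S, T, h1, h2⟩ := h.join_inv
    exact (Rule.join x _ Γ S T h1 (ih h2)).ty
  | congCut _ _ ih ih' =>
    obtain ⟨Γ₁, Γ₂, S, T, h1, h2, h3, h4⟩ := h.cut_inv
    exact (Rule.cut _ _ Γ Γ₁ Γ₂ S T h1 h2 (ih h3).rule (ih' h4).rule).ty
  | call A args _ => exact h.call_inv.2.2.2
  | link x y =>
    obtain ⟨h1, S, T, h2, rfl⟩ := h.link_inv
    have e : (Ctx.empty.set x S).set y T = (Ctx.empty.set y T).set x S := by funext z; grind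
    rw [e]
    exact (Rule.link y x T S h1.symm (by simpa using h2.dual)).ty
  | comm P Q =>
    obtain ⟨Γ₁, Γ₂, S, T, h1, h2, h3, h4⟩ := h.cut_inv
    exact (Rule.cut _ _ Γ Γ₂ Γ₁ T S h1.symm h2.symm h4.rule h3.rule).ty
  | wait B y P Q => exact h.precong_wait
  | case B y D P Q => exact h.precong_case
  | join B y P Q => exact h.precong_join
  | pull0 B B' y P => exact h.precong_pull0
  | pull1 y P Q R _ => exact h.precong_pull1
  | pull2 B y P Q => exact h.precong_pull2
  | pull3 B x y P Q h1 h2 => exact h.precong_pull3 h1 h2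
  | pull4 B B' x y P h1 h2 => exact h.precong_pull4 h1 h2

end Congruence

/-! ### Reduction preserves typing -/

section Reduction

variable {Tag Name : Type} {𝒟 : Program Tag Name} {P Q R : Proc Tag Name} {B B' : Buf Tag Name}
  {Γ Γ₁ ΓR : Ctx Tag} {S T U V : SType Tag} {x y : ℕ}

theorem Ty.fill_imp (hPQ : ∀ Γ, Ty 𝒟 P Γ → Ty 𝒟 Q Γ) (h : Ty 𝒟 (B.fill x P) Γ) :
    Ty 𝒟 (B.fill x Q) Γ := by
  induction B generalizing Γ with
  | hole => exact hPQ Γ h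
  | tag a B ih =>
    obtain ⟨m, U, V, h1, h2, h3⟩ := h.select_inv
    exact (Rule.select x a m _ Γ U V h1 h2 (ih h3).rule).ty
  | chan P B ih =>
    obtain ⟨Γ₁, Γ₂, U, S, V, h1, h2, h3, h4, h5⟩ := h.fork_inv
    exact (Rule.fork x _ _ Γ Γ₁ Γ₂ U S V h1 h2 h3 h4 (ih h5).rule).ty

theorem Ty.red_link (h : Ty 𝒟 (.cut (.link 0 (y + 1)) P) Γ) : Ty 𝒟 (P.rename (inst y)) Γ := by
  obtain ⟨Γ₁, Γ₂, S, T, hs, hc, h1, h2⟩ := h.cut_inv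
  obtain ⟨U, hl, rfl⟩ := h1.link_zero_inv
  have hy : Γ₂ y = none := hs.right_eq_none (S := U) (by grind)
  have e : Γ = Γ₂.set y U := by
    funext z
    have := hs z
    grind [Ctx.empty_apply]
  -- The type of the channel in `P` is a subtype of the one in `Γ`, not the same type.
  have hTS : FairSub T S.dual := fairSub_iff.2 (by simpa using hc)
  rw [e]
  exact (h2.rename (Ctx.renames_inst_bind hy)).sub ((Ctx.Sub.refl Γ₂).set (hTS.trans hl))

theorem Ty.close_zero_inv (h : Ty 𝒟 (.close 0) (Γ.bind S)) :
    S = .unit .out ∧ Γ = Ctx.empty := by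
  have e := h.close_inv
  have e0 := congrFun e 0
  simp only [Ctx.bind_zero, Ctx.set_apply] at e0
  refine ⟨Option.some.inj e0, funext fun z => ?_⟩
  simpa [Ctx.set_apply] using congrFun e (z + 1)

theorem Ty.red_close (h : Ty 𝒟 (.cut (.close 0) (.wait 0 (P.rename Nat.succ))) Γ) :
    Ty 𝒟 P Γ := by
  obtain ⟨Γ₁, Γ₂, S, T, hs, -, h1, h2⟩ := h.cut_inv
  obtain ⟨-, rfl⟩ := h1.close_zero_inv
  have e : Γ = (Γ₂.bind T).remove 0 ∘ Nat.succ := by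
    funext z
    have := hs z
    simp only [Function.comp_apply, Ctx.remove_apply, Nat.succ_eq_add_one, Ctx.bind_succ]
    grind [Ctx.empty_apply]
  rw [e]
  exact h2.wait_inv.2.of_rename Nat.succ_injective

/-- The payload of an output on the innermost channel does not use that channel. -/
theorem Ty.fork_zero_inv (h : Ty 𝒟 (.fork 0 P Q) (Γ.bind S)) : ∃ Γ₁ Γ₂ S' V,
    Step .out (.chan S') S V ∧ Ctx.Split Γ Γ₁ Γ₂ ∧ Ty 𝒟 P (Γ₁.shift.bind S') ∧
      Ty 𝒟 Q (Γ₂.bind V) := by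
  obtain ⟨Γ₁, Γ₂, U, S', V, h1, h2, h3, h4, h5⟩ := h.fork_inv
  cases h1
  have h0 : Γ₁ 0 = none ∧ Γ₂ 0 = none := h3.eq_none (by grind)
  rw [Ctx.eq_shift h0.1] at h4
  refine ⟨_, Γ₂ ∘ Nat.succ, S', V, h2, fun z => ?_, h4, ?_⟩
  · simpa [Ctx.remove_apply] using h3 (z + 1)
  · have : Γ₂.set 0 V = Ctx.bind (Γ₂ ∘ Nat.succ) V := by
      funext z
      cases z <;> simp [Ctx.set_apply]
    rwa [this] at h5

theorem Ty.select_zero_inv {a : Tag} (h : Ty 𝒟 (.select 0 a P) (Γ.bind S)) :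
    ∃ m V, Step .out (.tag a m) S V ∧ Ty 𝒟 P (Γ.bind V) := by
  obtain ⟨m, U, V, h1, h2, h3⟩ := h.select_inv
  cases h1
  rw [Ctx.bind_set_zero] at h3
  exact ⟨m, V, h2, h3⟩

theorem Ty.red_select {D : Finset Tag} {Q : {a // a ∈ D} → Proc Tag Name} {k : {a // a ∈ D}}
    (h : Ty 𝒟 (.cut (.select 0 k.1 P) (B.fill 0 (.case 0 D Q))) Γ) :
    Ty 𝒟 (.cut P (B.fill 0 (Q k))) Γ := by
  obtain ⟨Γ₁, Γ₂, S, T, hs, hc, h1, h2⟩ := h.cut_inv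
  obtain ⟨m, S', hS, h1⟩ := h1.select_zero_inv
  obtain ⟨ΓB, ΓR, V, hs', hB, h2⟩ := h2.fill_bind_inv
  obtain ⟨E, hE, m', W, hV, hED, h2⟩ := h2.case_inv
  cases hV
  obtain ⟨T', hT, hc'⟩ := hc.out_inp (σ := .tag k.1 m) trivial hS
  obtain ⟨V', hB', hV'⟩ := hB.step_inp hT
  obtain ⟨⟨k', hk'⟩, e, rfl⟩ := hV'.branch_inv
  obtain ⟨rfl, -⟩ := Msg.tag.inj e
  obtain ⟨W', e', hQ⟩ := h2 k
  rw [e' hk', Ctx.bind_set_zero] at hQ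
  exact (Rule.cut _ _ _ _ _ _ _ hs hc' h1.rule (hB'.fill_bind hs' hQ).rule).ty

theorem Ty.red_fork
    (h : Ty 𝒟 (.cut (.fork 0 (P.rename (lift Nat.succ)) Q) (B.fill 0 (.join 0 R))) Γ) :
    Ty 𝒟 (.cut P (.cut (Q.rename (lift Nat.succ))
      ((B.rename (lift Nat.succ)).fill 0 (R.rename exch)))) Γ := by
  obtain ⟨Γ₁, Γ₂, S, T, hs, hc, h1, h2⟩ := h.cut_inv
  obtain ⟨ΓP, ΓQ, S₁, S₂, hS, hs₁, hP, hQ⟩ := h1.fork_zero_inv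
  obtain ⟨ΓB, ΓR, V, hs', hB, h2⟩ := h2.fill_bind_inv
  obtain ⟨T₁, T₂, hV, hR⟩ := h2.join_inv
  cases hV
  obtain ⟨T₁', T', hT, hc₁, hc₂⟩ := hc.out_inp_chan hS
  obtain ⟨V', hB', hV'⟩ := hB.step_inp hT
  obtain ⟨e, rfl⟩ := hV'.mult_inv
  cases e
  obtain ⟨Γ₃, hs₂, hs₃⟩ := hs.assoc hs₁
  replace hP := hP.of_rename (lift_injective Nat.succ_injective)
  have e : ΓP.shift.bind S₁ ∘ lift Nat.succ = ΓP.bind S₁ := by funext z; cases z <;> rfl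
  rw [e] at hP
  rw [Ctx.bind_set_zero] at hR
  refine (Rule.cut _ _ _ _ _ _ _ hs₂ hc₁ hP.rule
    (Rule.cut _ _ _ _ _ _ _ hs₃.symm.bind_left.symm hc₂
      (hQ.rename ((Ctx.renames_succ ΓQ).bind _)).rule ?_)).ty
  exact ((hB'.rename (Ctx.renames_succ _).lift_shift).fill_bind hs'.symm.bind_left.symm
    (hR.rename (Ctx.renames_exch _ _ _))).rule

theorem Red.ty (hPQ : Red 𝒟 P Q) (h : Ty 𝒟 P Γ) : Ty 𝒟 Q Γ := by
  induction hPQ generalizing Γ with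
  | choiceLeft P Q => exact h.choice_inv.1
  | choiceRight P Q => exact h.choice_inv.2
  | link y P => exact h.red_link
  | close P => exact h.red_close
  | select B P D Q k => exact h.red_select
  | fork B P Q R => exact h.red_fork
  | cut R _ ih =>
    obtain ⟨Γ₁, Γ₂, S, T, h1, h2, h3, h4⟩ := h.cut_inv
    exact (Rule.cut _ _ Γ Γ₁ Γ₂ S T h1 h2 (ih h3).rule h4.rule).ty
  | buffer B x _ ih => exact h.fill_imp fun _ => ih
  | str h' _ ih => exact ih (h'.ty h)

/-! ### Threads -/

theorem Thread.inv (h : Thread P) : match P with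
    | .select _ _ P => Thread P
    | .fork _ _ Q => Thread Q
    | .choice _ _ => False
    | .call _ _ => False
    | .cut _ _ => False
    | _ => True := by
  induction h with
  | buffer B x h ih =>
    cases B with
    | hole => exact ih
    | tag a B => exact h.buffer B x
    | chan P B => exact h.buffer B x
  | _ => trivial

theorem Thread.select {a : Tag} (h : Thread P) : Thread (.select x a P) :=
  h.buffer (.tag a .hole) x

theorem Thread.fork (h : Thread Q) : Thread (.fork x P Q) := h.buffer (.chan P .hole) x

theorem Thread.of_rename {ρ : ℕ → ℕ} (h : Thread (P.rename ρ)) : Thread P := by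
  induction P generalizing ρ with
  | link => exact .link _ _
  | close => exact .close _
  | select x a P ih => exact (ih h.inv).select
  | fork x P Q _ ih => exact (ih h.inv).fork
  | choice => exact h.inv.elim
  | done => exact .done
  | call => exact h.inv.elim
  | wait => exact .wait _ _
  | case => exact .case _ _ _
  | join => exact .join _ _
  | cut => exact h.inv.elim

theorem Thread.eq_done (h : Thread P) (hP : ∀ x, x ∉ P.fn) : P = .done := by
  have h := h.inv
  cases P with
  | done => rfl
  | choice | call | cut => exact h.elim
  | link x | close x | select x | fork x | wait x | case x | join x =>
    exact (hP x (by simp [Proc.fn])).elim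

theorem PreCong.fill (h : PreCong 𝒟 P Q) : PreCong 𝒟 (B.fill x P) (B.fill x Q) := by
  induction B with
  | hole => exact h
  | tag a B ih => exact .congSelect x a ih
  | chan P B ih => exact .congFork x (.refl P) ih

/-- The processes that act on the innermost channel, other than by an output of a tag or of
a channel or by a link. -/
inductive Active : Proc Tag Name → Prop
  | close : Active (.close 0)
  | wait (P : Proc Tag Name) : Active (.wait 0 P)
  | case (D) (P : {a // a ∈ D} → Proc Tag Name) : Active (.case 0 D P)
  | join (P : Proc Tag Name) : Active (.join 0 P)

/-- Normal forms of the threads that use the innermost channel, from the point of view of a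
composition on that channel. In the first two cases and in the last three the composition can be
pushed under an action on another channel. In the case `core` the thread is about to act on the
innermost channel, with some outputs on it that are ready. -/
inductive Ready : Proc Tag Name → Prop
  | out (B : Buf Tag Name) (y : ℕ) {N : Proc Tag Name} :
      Ready N → Ready ((B.rename Nat.succ).fill (y + 1) N)
  | fork (y : ℕ) {P Q : Proc Tag Name} :
      1 ∈ P.fn → Thread Q → Ready (.fork (y + 1) P (Q.rename Nat.succ))
  | core (B : Buf Tag Name) {P : Proc Tag Name} :
      (Active P ∨ ∃ y, P = .link 0 (y + 1)) → Ready (B.fill 0 P)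
  | wait (B : Buf Tag Name) (y : ℕ) {P : Proc Tag Name} : 0 ∈ P.fn → Ready (B.fill 0 (.wait (y + 1) P))
  | case (B : Buf Tag Name) (y : ℕ) (D) {P : {a // a ∈ D} → Proc Tag Name} (i) : 0 ∈ (P i).fn →
      Ready (B.fill 0 (.case (y + 1) D P))
  | join (B : Buf Tag Name) (y : ℕ) {P : Proc Tag Name} : 1 ∈ P.fn → Ready (B.fill 0 (.join (y + 1) P))

theorem Ready.zero_mem_fn (h : Ready P) : 0 ∈ P.fn := by
  induction h with
  | out B y _ ih => exact Buf.mem_fn_fill ih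
  | fork y h _ => exact Or.inl (Or.inr h)
  | core B h =>
    refine Buf.mem_fn_fill ?_
    rcases h with h | ⟨y, rfl⟩
    · cases h <;> simp [Proc.fn]
    · simp [Proc.fn]
  | wait B y h => exact Buf.mem_fn_fill (Or.inr h)
  | case B y D i h => exact Buf.mem_fn_fill (Or.inr ⟨i, h⟩)
  | join B y h => exact Buf.mem_fn_fill (Or.inr h)

theorem Ready.fill (h : Ready P) (B : Buf Tag Name) :
    ∃ N, PreCong 𝒟 (B.fill 0 P) N ∧ Ready N := by
  induction h with
  | out C y h ih =>
    obtain ⟨N, h1, h2⟩ := ih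
    exact ⟨_, (PreCong.pull4 B _ 0 (y + 1) _ (by simp) h.zero_mem_fn).trans h1.fill, h2.out C y⟩
  | fork y h h' =>
    exact ⟨_, .pull3 B 0 (y + 1) _ _ (by simp) h, .fork y (Buf.mem_fn_fill h) h'⟩
  | core C h => rw [← Buf.fill_append]; exact ⟨_, .refl _, .core _ h⟩
  | wait C y h => rw [← Buf.fill_append]; exact ⟨_, .refl _, .wait _ y h⟩
  | case C y D i h => rw [← Buf.fill_append]; exact ⟨_, .refl _, .case _ y D i h⟩
  | join C y h => rw [← Buf.fill_append]; exact ⟨_, .refl _, .join _ y h⟩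

/-- Outputs on other channels are brought to the front of a thread, past the outputs on the
innermost channel (`Ready.fill`). Linearity decides which rule applies to the output of a channel:
the innermost channel occurs either in the payload or in the continuation. -/
theorem Thread.exists_ready (hP : Thread P) (h : Ty 𝒟 P Γ) (h0 : 0 ∈ P.fn) :
    ∃ N, PreCong 𝒟 P N ∧ Ready N := by
  induction P generalizing Γ with
  | link x y =>
    have hxy := h.link_inv.1
    rcases x with _ | x
    · obtain ⟨y, rfl⟩ := Nat.exists_eq_succ_of_ne_zero hxy.symm
      exact ⟨_, .refl _, .core .hole (Or.inr ⟨y, rfl⟩)⟩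
    · rcases y with _ | y
      · exact ⟨_, .link _ _, .core .hole (Or.inr ⟨x, rfl⟩)⟩
      · simp [Proc.fn] at h0
  | close x =>
    cases h0
    exact ⟨_, .refl _, .core .hole (Or.inl .close)⟩
  | select x a P ih =>
    obtain ⟨m, U, V, h1, h2, h3⟩ := h.select_inv
    rw [h.mem_fn] at h0
    obtain ⟨N, hN, hN'⟩ := ih hP.inv h3 (h3.mem_fn.2 (by grind))
    rcases x with _ | x
    · obtain ⟨N', h4, h5⟩ := hN'.fill (𝒟 := 𝒟) (.tag a .hole)
      exact ⟨N', (hN.congSelect 0 a).trans h4, h5⟩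
    · exact ⟨_, hN.congSelect _ a, hN'.out (.tag a .hole) x⟩
  | fork x P Q _ ih =>
    obtain ⟨Γ₁, Γ₂, U, S, V, h1, h2, h3, h4, h5⟩ := h.fork_inv
    rw [h.mem_fn] at h0
    have h30 := h3 0
    rcases x with _ | x
    · obtain ⟨N, hN, hN'⟩ := ih hP.inv h5 (h5.mem_fn.2 (by grind))
      obtain ⟨N', h6, h7⟩ := hN'.fill (𝒟 := 𝒟) (.chan P .hole)
      exact ⟨N', (PreCong.congFork 0 (.refl P) hN).trans h6, h7⟩
    · by_cases hP1 : 1 ∈ P.fn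
      · have hP1' := h4.mem_fn.1 hP1
        rw [Ctx.bind_succ] at hP1'
        obtain ⟨Q, rfl⟩ := Proc.exists_rename_succ (P := Q) <| by
          rw [h5.mem_fn]
          grind
        exact ⟨_, .refl _, .fork x hP1 (Thread.of_rename hP.inv)⟩
      · have hP1' := fun e => hP1 (h4.mem_fn.2 e)
        rw [Ctx.bind_succ] at hP1'
        obtain ⟨N, hN, hN'⟩ := ih hP.inv h5 (h5.mem_fn.2 (by grind))
        obtain ⟨P, rfl⟩ := Proc.exists_rename_lift_succ hP1
        exact ⟨_, .congFork _ (.refl _) hN, hN'.out (.chan P .hole) x⟩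
  | choice => exact hP.inv.elim
  | done => exact h0.elim
  | call => exact hP.inv.elim
  | wait x P =>
    rcases x with _ | x
    · exact ⟨_, .refl _, .core .hole (Or.inl (.wait P))⟩
    · exact ⟨_, .refl _, .wait .hole x (by simpa [Proc.fn] using h0)⟩
  | case x D P =>
    rcases x with _ | x
    · exact ⟨_, .refl _, .core .hole (Or.inl (.case D P))⟩
    · rcases h0 with h0 | ⟨i, hi⟩
      · cases h0
      · exact ⟨_, .refl _, .case .hole x D i hi⟩
  | join x P =>
    rcases x with _ | x
    · exact ⟨_, .refl _, .core .hole (Or.inl (.join P))⟩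
    · exact ⟨_, .refl _, .join .hole x (by simpa [Proc.fn] using h0)⟩
  | cut => exact hP.inv.elim

/-! ### Progress -/

/-- Either the process reduces or it can be rearranged into a thread. -/
def Progress (𝒟 : Program Tag Name) (P : Proc Tag Name) : Prop :=
  (∃ Q, Red 𝒟 P Q) ∨ ∃ Q, PreCong 𝒟 P Q ∧ Thread Q

theorem Progress.of_preCong (h : PreCong 𝒟 P Q) (hQ : Progress 𝒟 Q) : Progress 𝒟 P := by
  rcases hQ with ⟨R, hR⟩ | ⟨R, h1, h2⟩
  · exact Or.inl ⟨R, hR.str h⟩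
  · exact Or.inr ⟨R, h.trans h1, h2⟩

theorem Progress.fill (h : Progress 𝒟 P) (B : Buf Tag Name) (x : ℕ) :
    Progress 𝒟 (B.fill x P) := by
  rcases h with ⟨R, hR⟩ | ⟨R, h1, h2⟩
  · exact Or.inl ⟨_, hR.buffer B x⟩
  · exact Or.inr ⟨_, h1.fill, h2.buffer B x⟩

theorem Ty.exists_of_fill (h : Ty 𝒟 (B.fill x P) Γ) : ∃ Δ, Ty 𝒟 P Δ := by
  rcases h.fill_eq_some with rfl | ⟨U, hU⟩
  · exact ⟨Γ, h⟩
  · obtain ⟨ΓB, ΓR, V, -, -, hP⟩ := h.fill_inv hU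
    exact ⟨_, hP⟩

/-- In a composition, it is enough to consider the threads about to act on the channel that
connects them. -/
theorem Ready.progress_cut (hP : Ready P) (h : Ty 𝒟 (.cut P Q) Γ)
    (core : ∀ (B : Buf Tag Name) P Γ, (Active P ∨ ∃ y, P = .link 0 (y + 1)) →
      Ty 𝒟 (.cut (B.fill 0 P) Q) Γ → Progress 𝒟 (.cut (B.fill 0 P) Q)) :
    Progress 𝒟 (.cut P Q) := by
  induction hP generalizing Γ with
  | out B y _ ih =>
    have hc := PreCong.pull2 (𝒟 := 𝒟) B y
    obtain ⟨Δ, hΔ⟩ := ((hc _ _).ty h).exists_of_fill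
    exact .of_preCong (hc _ _) ((ih hΔ).fill B y)
  | fork y h1 h2 => exact Or.inr ⟨_, .pull1 y _ _ _ h1, h2.fork⟩
  | core B h' => exact core B _ Γ h' h
  | wait B y _ => exact Or.inr ⟨_, .wait B y _ _, .wait _ _⟩
  | case B y D i _ => exact Or.inr ⟨_, .case B y D _ _, .case _ _ _⟩
  | join B y _ => exact Or.inr ⟨_, .join B y _ _, .join _ _⟩

/-- If the thread on the left has an output ready, then the one on the right, which is not
a link, is waiting for it, because the inputs of its type commute with the outputs in its
buffer. -/
theorem Active.red_of_output (hQ : Active Q) (hB : B ≠ .hole)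
    (h : Ty 𝒟 (.cut (B.fill 0 P) (B'.fill 0 Q)) Γ) :
    ∃ R, Red 𝒟 (.cut (B.fill 0 P) (B'.fill 0 Q)) R := by
  obtain ⟨Γ₁, Γ₂, S, T, hs, hc, h1, h2⟩ := h.cut_inv
  obtain ⟨ΓB, ΓR, V, -, hB', h2⟩ := h2.fill_bind_inv
  cases B with
  | hole => exact (hB rfl).elim
  | tag a B =>
    obtain ⟨m, S', hS, -⟩ := h1.select_zero_inv
    obtain ⟨T', hT, -⟩ := hc.out_inp (σ := .tag a m) trivial hS
    obtain ⟨V', -, hV⟩ := hB'.step_inp hT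
    cases hQ with
    | close =>
      rw [h2.close_zero_inv.1] at hV
      cases hV.unit_inv.1
    | wait P =>
      cases h2.wait_inv.1
      cases hV.unit_inv.2.1
    | case D Q =>
      obtain ⟨E, hE, m', W, e, hED, -⟩ := h2.case_inv
      cases e
      obtain ⟨⟨k, hk⟩, e, -⟩ := hV.branch_inv
      obtain ⟨rfl, -⟩ := Msg.tag.inj e
      exact ⟨_, .select B' _ D Q ⟨a, hED a hk⟩⟩
    | join R =>
      obtain ⟨T₁, T₂, e, -⟩ := h2.join_inv
      cases e
      cases hV.mult_inv.1
  | chan P' B =>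
    obtain ⟨ΓP, ΓQ, S₁, S₂, hS, -, hP, -⟩ := h1.fork_zero_inv
    obtain ⟨T₁, T₂, hT, -⟩ := hc.out_inp_chan hS
    obtain ⟨V', -, hV⟩ := hB'.step_inp hT
    cases hQ with
    | close =>
      rw [h2.close_zero_inv.1] at hV
      cases hV.unit_inv.1
    | wait P =>
      cases h2.wait_inv.1
      cases hV.unit_inv.2.1
    | case D Q =>
      obtain ⟨E, hE, m', W, e, hED, -⟩ := h2.case_inv
      cases e
      obtain ⟨k, e, -⟩ := hV.branch_inv
      cases e
    | join R =>
      obtain ⟨P', rfl⟩ := Proc.exists_rename_lift_succ (P := P') <| by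
        rw [hP.mem_fn]
        simp
      exact ⟨_, .fork B' P' _ R⟩

theorem Active.progress_close (hQ : Active Q) (h : Ty 𝒟 (.cut (.close 0) Q) Γ) :
    Progress 𝒟 (.cut (.close 0) Q) := by
  obtain ⟨Γ₁, Γ₂, S, T, hs, hc, h1, h2⟩ := h.cut_inv
  rw [h1.close_zero_inv.1] at hc
  have hT := hc.symm.eq_unit_inp
  subst hT
  cases hQ with
  | close => cases SType.unit_inj h2.close_zero_inv.1
  | wait P =>
    obtain ⟨P, rfl⟩ := Proc.exists_rename_succ (P := P) <| by
      rw [h2.wait_inv.2.mem_fn]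
      simp [Ctx.remove_apply]
    exact Or.inl ⟨_, .close P⟩
  | case D Q =>
    obtain ⟨E, hE, m', W, e, -⟩ := h2.case_inv
    exact (SType.unit_ne_branch (Option.some.inj e)).elim
  | join R =>
    obtain ⟨T₁, T₂, e, -⟩ := h2.join_inv
    exact (SType.unit_ne_mult (Option.some.inj e)).elim

/-- Among the active processes, the types of all but `close` are negative. -/
theorem Active.eq_close (hP : Active P) (h : Ty 𝒟 P (Γ.bind S)) (hS : S.Pos) : P = .close 0 := by
  cases hP with
  | close => rfl
  | wait P => cases h.wait_inv.1; cases SType.pos_unit.1 hS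
  | case D Q =>
    obtain ⟨E, hE, m', W, e, -⟩ := h.case_inv
    cases e; cases SType.pos_branch.1 hS
  | join R =>
    obtain ⟨T₁, T₂, e, -⟩ := h.join_inv
    cases e; cases SType.pos_mult.1 hS

/-- Whatever precedes the link in its thread, the outputs in the other thread can be forwarded
through the link. What remains in the other thread is either a link or waiting. -/
theorem progress_cut_link (hP : Active P ∨ ∃ y, P = .link 0 (y + 1))
    (h : Ty 𝒟 (.cut (B.fill 0 P) (B'.fill 0 (.link 0 (y + 1)))) Γ) :
    Progress 𝒟 (.cut (B.fill 0 P) (B'.fill 0 (.link 0 (y + 1)))) := by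
  have hc := PreCong.pull0 (𝒟 := 𝒟) B B' y P
  refine .of_preCong hc (.fill ?_ _ y)
  obtain ⟨Δ, h⟩ := (hc.ty h).exists_of_fill
  rcases hP with hP | ⟨z, rfl⟩
  · refine .of_preCong (.comm _ _) ?_
    by_cases hB : B' = .hole
    · subst hB
      exact Or.inl ⟨_, .link y P⟩
    · exact Or.inl (hP.red_of_output (B' := .hole) hB ((PreCong.comm _ _).ty h))
  · exact Or.inl ⟨_, .link z _⟩

theorem progress_cut_core (hP : Active P ∨ ∃ y, P = .link 0 (y + 1))
    (hQ : Active Q ∨ ∃ y, Q = .link 0 (y + 1)) (h : Ty 𝒟 (.cut (B.fill 0 P) (B'.fill 0 Q)) Γ) :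
    Progress 𝒟 (.cut (B.fill 0 P) (B'.fill 0 Q)) := by
  rcases hQ with hQ | ⟨y, rfl⟩
  · have h' := (PreCong.comm _ _).ty h
    rcases hP with hP | ⟨y, rfl⟩
    · by_cases hB : B = .hole
      · by_cases hB' : B' = .hole
        · subst hB hB'
          obtain ⟨Γ₁, Γ₂, S, T, -, hc, h1, h2⟩ := h.cut_inv
          rcases isCorrectComposition_correct.pos hc with hS | hT
          · cases hP.eq_close h1 hS
            exact hQ.progress_close h
          · cases hQ.eq_close h2 hT
            exact .of_preCong (.comm _ _) (hP.progress_close h')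
        · exact .of_preCong (.comm _ _) (Or.inl (hP.red_of_output hB' h'))
      · exact Or.inl (hQ.red_of_output hB h)
    · exact .of_preCong (.comm _ _) (progress_cut_link (Or.inl hQ) h')
  · exact progress_cut_link hP h

theorem Ready.progress (hP : Ready P) (hQ : Ready Q) (h : Ty 𝒟 (.cut P Q) Γ) :
    Progress 𝒟 (.cut P Q) := by
  refine hP.progress_cut h fun B P Γ hP h => .of_preCong (.comm _ _) ?_
  exact hQ.progress_cut ((PreCong.comm _ _).ty h) fun B' Q Γ hQ h => progress_cut_core hQ hP h

/-- Progress, by induction on the first layer of the typing derivation. -/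
theorem Rule.progress (h : Rule 𝒟 (Ty 𝒟) P Γ) : Progress 𝒟 P := by
  induction h with
  | done => exact Or.inr ⟨_, .refl _, .done⟩
  | link x y => exact Or.inr ⟨_, .refl _, .link x y⟩
  | call A args Γ h1 _ _ _ ih => exact .of_preCong (.call A args h1) ih
  | choice P Q => exact Or.inl ⟨_, .choiceLeft P Q⟩
  | cut P Q Γ Γ₁ Γ₂ S T hs hc hP hQ ihP ihQ =>
    rcases ihP with ⟨R, hR⟩ | ⟨P', hP', hP''⟩
    · exact Or.inl ⟨_, hR.cut Q⟩
    rcases ihQ with ⟨R, hR⟩ | ⟨Q', hQ', hQ''⟩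
    · exact .of_preCong (.comm _ _) (Or.inl ⟨_, hR.cut P⟩)
    have hP₁ := hP'.ty hP.ty
    have hQ₁ := hQ'.ty hQ.ty
    obtain ⟨N, hN, hN'⟩ := hP''.exists_ready hP₁ (hP₁.mem_fn.2 (by simp))
    obtain ⟨M, hM, hM'⟩ := hQ''.exists_ready hQ₁ (hQ₁.mem_fn.2 (by simp))
    have hc' : PreCong 𝒟 (.cut P Q) (.cut N M) := .congCut (hP'.trans hN) (hQ'.trans hM)
    exact .of_preCong hc' (hN'.progress hM' (hc'.ty (Rule.cut _ _ _ _ _ _ _ hs hc hP hQ).ty))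
  | close x => exact Or.inr ⟨_, .refl _, .close x⟩
  | wait x P => exact Or.inr ⟨_, .refl _, .wait x P⟩
  | select x a m P Γ U V _ _ _ ih => exact ih.fill (.tag a .hole) x
  | case x D P => exact Or.inr ⟨_, .refl _, .case x D P⟩
  | fork x P Q Γ Γ₁ Γ₂ U S V _ _ _ _ _ ih => exact ih.fill (.chan P .hole) x
  | join x P => exact Or.inr ⟨_, .refl _, .join x P⟩

/-- In the empty context the only threads are terminated. -/
theorem Ty.deadlockFree (h : Ty 𝒟 P Ctx.empty) : DeadlockFree 𝒟 P := by
  intro Q hPQ hQ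
  have hT : Ty 𝒟 Q Ctx.empty := by
    clear hQ
    induction hPQ with
    | refl => exact h
    | tail _ hR ih => exact hR.ty ih
  obtain ⟨R, hR, hR'⟩ := hT.rule.progress.resolve_left hQ
  have : R = .done := hR'.eq_done fun x hx => (hR.ty hT).mem_fn.1 hx rfl
  rwa [this] at hR

end Reduction

end CaP

theorem mainTheorem3 {Tag Name : Type} (𝒟 : CaP.Program Tag Name) :
    (∀ P : CaP.Proc Tag Name, CaP.WellTyped 𝒟 P CaP.Ctx.empty → CaP.DeadlockFree 𝒟 P) ∧
    (∀ (P : CaP.Proc Tag Name) (Γ : CaP.Ctx Tag), CaP.WellTyped 𝒟 P Γ →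
      (∃ Q, CaP.Red 𝒟 P Q) ∨ ∃ Q, CaP.PreCong 𝒟 P Q ∧ CaP.Thread Q) :=
  ⟨fun _ h => h.ty.deadlockFree, fun _ _ h => h.ty.rule.progress⟩
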